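/- For each $n\ge 1$ let $\mathbf y=\mathbf f+\boldsymbol\epsilon=\mathbf X\boldsymbol\beta+\boldsymbol\epsilon\in\mathbb R^n$, where $\mathbf X\in\mathbb R^{n\times p_n}$ is nonrandom with full column rank $p_n\le n$, and $\epsilon_1,\dots,\epsilon_n$ are i.i.d. sub-Gaussian with mean $0$ and variance $\sigma^2>0$; $\sigma^2$ and the sub-Gaussian parameter do not depend on $n$. Let $1\le k_1<\dots<k_{M_n}\le p_n$ ($M_n\ge1$, $k_0=0$; all may depend on $n$) and let $\mathcal M=\{\{1,\dots,k_m\}:1\le m\le M_n\}$ be the nested candidate models. Write $\mathbf P_{m|\mathcal M}$ for the least squares projection matrix $\mathbf X_{\mathcal I}(\mathbf X_{\mathcal I}^\top\mathbf X_{\mathcal I})^{-1}\mathbf X_{\mathcal I}^\top$ with $\mathcal I=\{1,\dots,k_m\}$. For $\mathbf w$ in the unit simplex $\mathcal W_{M_n}\subset\mathbb R^{M_n}$ put $$\hat{\mathbf f}_{\mathbf w|\mathcal M}=\sum_{m=1}^{M_n}w_m\mathbf P_{m|\mathcal M}\mathbf y,\qquad L_n(\mathbf w|\mathcal M,\mathbf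 f)=\tfrac1n\|\hat{\mathbf f}_{\mathbf w|\mathcal M}-\mathbf f\|^2,\qquad R_n(\mathbf w|\mathcal M,\mathbf f)=\mathbb E L_n(\mathbf w|\mathcal M,\mathbf f),$$ and let $R_n(\mathbf w^*|\mathcal M,\mathbf f)=\min_{\mathbf w\in\mathcal W_{M_n}}R_n(\mathbf w|\mathcal M,\mathbf f)$. Let $\hat\sigma^2$ be an estimator of $\sigma^2$, square integrable for all large $n$, and let $\hat{\mathbf w}$ be a minimizer over $\mathcal W_{M_n}$ of the Mallows model averaging (MMA) criterion $$C_n(\mathbf w|\mathcal M,\mathbf y)=\tfrac1n\|\mathbf y-\hat{\mathbf f}_{\mathbf w|\mathcal M}\|^2+\tfrac{2\hat\sigma^2}{n}\sum_{m=1}^{M_n}k_mw_m .$$ Let $\theta_j=\boldsymbol\phi_j^\top\mathbf f/\sqrt n$ $(1\le j\le p_n)$, where $\boldsymbol\phi_1,\dots,\boldsymbol\phi_{p_n}$ are the unit vectors (unique up to sign) such that $\boldsymbol\phi_j\boldsymbol\phi_j^\top$ is the difference of the orthogonal projections onto the spans of the first $j$ and of the first $j-1$ columns of $\mathbf X$.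 Let $S_j=\sum_{l=k_j+1}^{k_{M_n}}\theta_l^2$ for $0\le j\le M_n$ (so $S_{M_n}=0$), $M_n'=\min\{1\le j\le M_n:S_j=0\}$, and $$\psi(\mathcal M)=\Big[M_n\wedge\Big(1+\sum_{j=1}^{M_n-1}\frac{k_{j+1}-k_j}{4k_j}+\sum_{j=1}^{M_n'-1}\frac{S_{j-1}-S_j}{4S_j}\Big)\Big](1+\log M_n)^2 .$$ Suppose that $\limsup_n n^{-1}\|\mathbf f\|^2<\infty$ and that, as $n\to\infty$, $$k_{M_n}\,\mathbb E(\hat\sigma^2-\sigma^2)^2=o\big[nR_n(\mathbf w^*|\mathcal M,\mathbf f)\big]\quad\text{and}\quad \psi(\mathcal M)=o\big[nR_n(\mathbf w^*|\mathcal M,\mathbf f)\big].$$ Then $$\frac{L_n(\hat{\mathbf w}|\mathcal M,\mathbf f)}{\inf_{\mathbf w\in\mathcal W_{M_n}}L_n(\mathbf w|\mathcal M,\mathbf f)}\longrightarrow 1\quad\text{in probability as } n\to\infty .$$ -/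

import Mathlib

open MeasureTheory ProbabilityTheory Filter Asymptotics
open scoped Matrix NNReal Topology

noncomputable section

namespace ModelAveraging

/-- The squared Euclidean norm of a vector in `ℝⁿ`. -/
def sqNorm {n : ℕ} (v : Fin n → ℝ) : ℝ := ∑ i, v i ^ 2

/-- The least squares hat matrix `X_I (X_Iᵀ X_I)⁻¹ X_Iᵀ` of the candidate model with the
regressors in `I`. -/
def hatMatrix {n p : ℕ} (X : Matrix (Fin n) (Fin p) ℝ) (I : Finset (Fin p)) :
    Matrix (Fin n) (Fin n) ℝ :=
  let XI : Matrix (Fin n) I ℝ := X.submatrix id (fun j : I => (j : Fin p))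
  XI * (XIᵀ * XI)⁻¹ * XIᵀ

/-- The model averaging estimator `∑ m, w_m P_{I_m} y`. -/
def maEstimator {n p M : ℕ} (X : Matrix (Fin n) (Fin p) ℝ) (I : Fin M → Finset (Fin p))
    (w : Fin M → ℝ) (y : Fin n → ℝ) : Fin n → ℝ :=
  ∑ m, w m • (hatMatrix X (I m) *ᵥ y)

/-- The normalized squared loss `n⁻¹ ‖f̂_w - f‖²` of the averaging estimator with weights `w`
computed from the response `y`. -/
def maLoss {n p M : ℕ} (X : Matrix (Fin n) (Fin p) ℝ) (I : Fin M → Finset (Fin p))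
    (f : Fin n → ℝ) (w : Fin M → ℝ) (y : Fin n → ℝ) : ℝ :=
  (n : ℝ)⁻¹ * sqNorm (maEstimator X I w y - f)

/-- The least loss over the weights in the unit simplex. -/
def minLoss {n p M : ℕ} (X : Matrix (Fin n) (Fin p) ℝ) (I : Fin M → Finset (Fin p))
    (f : Fin n → ℝ) (y : Fin n → ℝ) : ℝ :=
  ⨅ w : stdSimplex ℝ (Fin M), maLoss X I f w y

/-- The risk of the averaging estimator with nonrandom weights `w`: the expected loss when the
response is `f + ε`. -/
def maRisk {Ω : Type*} [MeasurableSpace Ω] (P : Measure Ω) {n p M : ℕ}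
    (X : Matrix (Fin n) (Fin p) ℝ) (I : Fin M → Finset (Fin p)) (f : Fin n → ℝ)
    (ε : Fin n → Ω → ℝ) (w : Fin M → ℝ) : ℝ :=
  ∫ ω, maLoss X I f w (fun i => f i + ε i ω) ∂P

/-- The optimal risk over the (nonrandom) weights in the unit simplex. -/
def optRisk {Ω : Type*} [MeasurableSpace Ω] (P : Measure Ω) {n p M : ℕ}
    (X : Matrix (Fin n) (Fin p) ℝ) (I : Fin M → Finset (Fin p)) (f : Fin n → ℝ)
    (ε : Fin n → Ω → ℝ) : ℝ :=
  ⨅ w : stdSimplex ℝ (Fin M), maRisk P X I f ε w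

/-- The Mallows model averaging criterion, `s2` being the value of the estimator of the error
variance. -/
def mmaCriterion {n p M : ℕ} (X : Matrix (Fin n) (Fin p) ℝ) (I : Fin M → Finset (Fin p))
    (s2 : ℝ) (y : Fin n → ℝ) (w : Fin M → ℝ) : ℝ :=
  (n : ℝ)⁻¹ * sqNorm (y - maEstimator X I w y)
    + 2 * s2 / n * ∑ m, ((I m).card : ℝ) * w m

/-- The model with the first `r` regressors. -/
def initialModel (p r : ℕ) : Finset (Fin p) := Finset.univ.filter fun j => (j : ℕ) < r

/-- The nested candidate models: the `m`-th one (`m = 1, …, M`) has the first `k m` regressors.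
The type `Fin M` counts from `0`, the sizes `k` from `1`. -/
def nestedModels (p M : ℕ) (k : ℕ → ℕ) : Fin M → Finset (Fin p) :=
  fun m => initialModel p (k (m + 1))

/-- `1 ≤ k 1 < ⋯ < k M ≤ p` with `M ≥ 1`, and the convention `k 0 = 0`. -/
structure IsNestedSizes (p M : ℕ) (k : ℕ → ℕ) : Prop where
  one_le : 1 ≤ M
  zero : k 0 = 0
  strictMonoOn : StrictMonoOn k (Set.Icc 0 M)
  le : k M ≤ p

/-- The vectors `φ_j`: the columns of `X`, orthonormalized in their order. They are the unit
vectors (unique up to sign) with `P_j - P_{j-1} = φ_j φ_jᵀ`, where `P_j` is the hat matrix of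
the first `j` regressors; see `hatMatrix_sub_hatMatrix` below. -/
def phi {n p : ℕ} (X : Matrix (Fin n) (Fin p) ℝ) (j : Fin p) : Fin n → ℝ :=
  WithLp.ofLp (InnerProductSpace.gramSchmidtNormed ℝ
    (fun l : Fin p => (WithLp.toLp 2 (X.col l) : EuclideanSpace ℝ (Fin n))) j)

theorem linearIndependent_col {n p : ℕ} (X : Matrix (Fin n) (Fin p) ℝ) (hX : X.rank = p) :
    LinearIndependent ℝ X.col := by
  rw [linearIndependent_iff_card_eq_finrank_span, Fintype.card_fin]
  rw [Matrix.rank_eq_finrank_span_cols] at hX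
  exact hX.symm

/-- With `X` of full column rank, the hat matrix is the orthogonal projection onto the span of
the chosen columns. -/
theorem hatMatrix_mulVec {n p : ℕ} (X : Matrix (Fin n) (Fin p) ℝ) (hX : X.rank = p)
    (I : Finset (Fin p)) (y : Fin n → ℝ) :
    (WithLp.toLp 2 (hatMatrix X I *ᵥ y) : EuclideanSpace ℝ (Fin n)) =
      (Submodule.span ℝ ((fun l : Fin p => (WithLp.toLp 2 (X.col l) : EuclideanSpace ℝ (Fin n)))
        '' (I : Set (Fin p)))).starProjection (WithLp.toLp 2 y) := by
  have hli := linearIndependent_col X hX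
  set XI : Matrix (Fin n) I ℝ := X.submatrix id (fun j : I => (j : Fin p)) with hXI
  have hliI : LinearIndependent ℝ XI.col :=
    hli.comp (fun j : I => (j : Fin p)) Subtype.val_injective
  have hinj : Function.Injective XI.mulVec := Matrix.mulVec_injective_iff.2 hliI
  have hpd : (XIᵀ * XI).PosDef := by
    have := Matrix.PosDef.conjTranspose_mul_self XI hinj
    rwa [Matrix.conjTranspose_eq_transpose_of_trivial] at this
  have hdet : IsUnit (XIᵀ * XI).det := (Matrix.isUnit_iff_isUnit_det _).1 hpd.isUnit
  have hH : hatMatrix X I = XI * (XIᵀ * XI)⁻¹ * XIᵀ := rfl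
  have hXH : XIᵀ * hatMatrix X I = XIᵀ := by
    rw [hH, ← Matrix.mul_assoc, ← Matrix.mul_assoc, Matrix.mul_nonsing_inv _ hdet,
      Matrix.one_mul]
  symm
  apply Submodule.eq_starProjection_of_mem_of_inner_eq_zero
  · have : hatMatrix X I *ᵥ y = XI *ᵥ (((XIᵀ * XI)⁻¹ * XIᵀ) *ᵥ y) := by
      rw [hH, Matrix.mulVec_mulVec, Matrix.mul_assoc]
    rw [this, Matrix.mulVec_eq_sum, WithLp.toLp_sum]
    refine Submodule.sum_mem _ fun j _ => ?_
    simp only [op_smul_eq_smul, WithLp.toLp_smul]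
    exact Submodule.smul_mem _ _ (Submodule.subset_span ⟨j, j.2, rfl⟩)
  · intro w hw
    induction hw using Submodule.span_induction with
    | mem w hw =>
      obtain ⟨l, hl, rfl⟩ := hw
      have h1 : XIᵀ *ᵥ (y - hatMatrix X I *ᵥ y) = 0 := by
        rw [Matrix.mulVec_sub, Matrix.mulVec_mulVec, hXH, sub_self]
      have h2 : X.col l ⬝ᵥ (y - hatMatrix X I *ᵥ y) = 0 := congrFun h1 ⟨l, hl⟩
      rw [← WithLp.toLp_sub]
      simpa [EuclideanSpace.inner_eq_star_dotProduct, dotProduct_comm] using h2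
    | zero => simp
    | add a b _ _ ha hb => rw [inner_add_right, ha, hb, add_zero]
    | smul c a _ ha => rw [inner_smul_right, ha, mul_zero]

/-- The defining property of `phi`: `P_j - P_{j-1} = φ_j φ_jᵀ`. -/
theorem hatMatrix_sub_hatMatrix {n p : ℕ} (X : Matrix (Fin n) (Fin p) ℝ) (hX : X.rank = p)
    (j : Fin p) :
    hatMatrix X (initialModel p (j + 1)) - hatMatrix X (initialModel p j) =
      Matrix.vecMulVec (phi X j) (phi X j) := by
  have hli := linearIndependent_col X hX
  set e : Fin p → EuclideanSpace ℝ (Fin n) := fun l => WithLp.toLp 2 (X.col l) with he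
  have hle : LinearIndependent ℝ e :=
    hli.map' (WithLp.linearEquiv 2 ℝ (Fin n → ℝ)).symm.toLinearMap (LinearEquiv.ker _)
  set φ := InnerProductSpace.gramSchmidtNormed ℝ e with hφ
  have hon : Orthonormal ℝ φ := InnerProductSpace.gramSchmidtNormed_orthonormal hle
  have hIic : Submodule.span ℝ (e '' (initialModel p (j + 1) : Set (Fin p))) =
      Submodule.span ℝ (φ '' Set.Iic j) := by
    rw [hφ, InnerProductSpace.span_gramSchmidtNormed, InnerProductSpace.span_gramSchmidt_Iic]
    congr 2
    ext l
    simp [initialModel]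
  have hIio : Submodule.span ℝ (e '' (initialModel p j : Set (Fin p))) =
      Submodule.span ℝ (φ '' Set.Iio j) := by
    rw [hφ, InnerProductSpace.span_gramSchmidtNormed, InnerProductSpace.span_gramSchmidt_Iio]
    congr 2
    ext l
    simp [initialModel]
  have horth : ∀ w ∈ Submodule.span ℝ (φ '' Set.Iio j), inner ℝ w (φ j) = 0 := by
    intro w hw
    induction hw using Submodule.span_induction with
    | mem w hw =>
      obtain ⟨l, hl, rfl⟩ := hw
      exact hon.2 (ne_of_lt hl)
    | zero => simp
    | add a b _ _ ha hb => rw [inner_add_left, ha, hb, add_zero]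
    | smul c a _ ha => rw [inner_smul_left, ha, mul_zero]
  have hmain : ∀ v : EuclideanSpace ℝ (Fin n),
      (Submodule.span ℝ (φ '' Set.Iic j)).starProjection v =
        (Submodule.span ℝ (φ '' Set.Iio j)).starProjection v + inner ℝ (φ j) v • φ j := by
    intro v
    have hKm := Submodule.starProjection_apply_mem (Submodule.span ℝ (φ '' Set.Iio j)) v
    apply Submodule.eq_starProjection_of_mem_of_inner_eq_zero
    · refine Submodule.add_mem _ ?_ (Submodule.smul_mem _ _
        (Submodule.subset_span ⟨j, Set.mem_Iic.2 le_rfl, rfl⟩))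
      exact Submodule.span_mono (Set.image_mono Set.Iio_subset_Iic_self) hKm
    · intro w hw
      induction hw using Submodule.span_induction with
      | mem w hw =>
        obtain ⟨l, hl, rfl⟩ := hw
        rcases lt_or_eq_of_le (Set.mem_Iic.1 hl) with h | rfl
        · have h1 := Submodule.starProjection_inner_eq_zero (K := Submodule.span ℝ (φ '' Set.Iio j))
            v (φ l) (Submodule.subset_span ⟨l, h, rfl⟩)
          have h2 : inner ℝ (φ j) (φ l) = 0 := hon.2 (ne_of_gt h)
          rw [← sub_sub, inner_sub_left, h1, inner_smul_left, h2]
          simp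
        · have h1 := horth _ hKm
          have h2 : inner ℝ (φ l) (φ l) = 1 := by
            rw [real_inner_self_eq_norm_sq, hon.1 l]; norm_num
          rw [inner_sub_left, inner_add_left, h1, inner_smul_left, h2, real_inner_comm]
          simp
      | zero => simp
      | add a b _ _ ha hb => rw [inner_add_right, ha, hb, add_zero]
      | smul c a _ ha => rw [inner_smul_right, ha, mul_zero]
  apply Matrix.ext_of_mulVec_single
  intro i
  have h := hmain (WithLp.toLp 2 (Pi.single i 1))
  rw [← hIic, ← hIio, ← hatMatrix_mulVec X hX, ← hatMatrix_mulVec X hX] at h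
  have h' := congrArg WithLp.ofLp h
  rw [Matrix.sub_mulVec, sub_eq_iff_eq_add']
  refine h'.trans ?_
  ext a
  simp [phi, Matrix.vecMulVec_apply, EuclideanSpace.inner_eq_star_dotProduct, mul_comm, ← he, ← hφ]

/-- The vectors `phi` are unit vectors. -/
theorem phi_dotProduct_phi {n p : ℕ} (X : Matrix (Fin n) (Fin p) ℝ) (hX : X.rank = p)
    (j : Fin p) : phi X j ⬝ᵥ phi X j = 1 := by
  have hli := linearIndependent_col X hX
  have hle : LinearIndependent ℝ
      (fun l : Fin p => (WithLp.toLp 2 (X.col l) : EuclideanSpace ℝ (Fin n))) :=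
    hli.map' (WithLp.linearEquiv 2 ℝ (Fin n → ℝ)).symm.toLinearMap (LinearEquiv.ker _)
  have h := (InnerProductSpace.gramSchmidtNormed_orthonormal hle).1 j
  have h2 := real_inner_self_eq_norm_sq (InnerProductSpace.gramSchmidtNormed ℝ
    (fun l : Fin p => (WithLp.toLp 2 (X.col l) : EuclideanSpace ℝ (Fin n))) j)
  rw [h, EuclideanSpace.inner_eq_star_dotProduct, one_pow] at h2
  exact h2

/-- The transformed coefficients `θ_j = φ_jᵀ f / √n`. -/
def theta {n p : ℕ} (X : Matrix (Fin n) (Fin p) ℝ) (f : Fin n → ℝ) (j : Fin p) : ℝ :=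
  (phi X j ⬝ᵥ f) / √(n : ℝ)

/-- `S_j = ∑_{l = k_j + 1}^{k_M} θ_l²`; the element `l` of `Fin p` is the regressor number
`l + 1`. -/
def tailSum {p : ℕ} (θ : Fin p → ℝ) (M : ℕ) (k : ℕ → ℕ) (j : ℕ) : ℝ :=
  ∑ l ∈ Finset.univ.filter (fun l : Fin p => k j < (l : ℕ) + 1 ∧ (l : ℕ) + 1 ≤ k M), θ l ^ 2

/-- `M' = min {1 ≤ j ≤ M : S_j = 0}`. The set contains `M`, since `S_M` is an empty sum. -/
def firstZero {p : ℕ} (θ : Fin p → ℝ) (M : ℕ) (k : ℕ → ℕ) : ℕ :=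
  sInf {j | 1 ≤ j ∧ j ≤ M ∧ tailSum θ M k j = 0}

/-- The complexity `ψ` of a nested candidate model set. -/
def psi {p : ℕ} (θ : Fin p → ℝ) (M : ℕ) (k : ℕ → ℕ) : ℝ :=
  min (M : ℝ)
      (1 + ∑ j ∈ Finset.Ico 1 M, ((k (j + 1) : ℝ) - k j) / (4 * k j)
        + ∑ j ∈ Finset.Ico 1 (firstZero θ M k),
            (tailSum θ M k (j - 1) - tailSum θ M k j) / (4 * tailSum θ M k j))
    * (1 + Real.log M) ^ 2

end ModelAveraging

end

open ModelAveraging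

/-! Let γ_j be the total weight of the models with (zero-based) index at least j, a nonincreasing
sequence in [0, 1]. In the orthonormal system `phi`, the averaging estimator multiplies the
coefficients of y in the j-th block, regressors k_j + 1 to k_{j+1}, by γ_j. With T_j the energy of f
in that block and d_j its size, n times the risk is therefore bias + ∑ (1 - γ_j)² T_j + σ² ∑ γ_j²
d_j.

Let Ξ_j be the noise-signal inner product and Q_j the centred noise energy in block j. Loss minus
risk, and criterion minus loss up to a term free of w, are combinations of ∑ α_j Ξ_j with α = 1 - γ
or (1 - γ)², of ∑ α_j Q_j with α = γ or γ², and of (σ̂² - σ²) ∑ γ_j d_j. If all of these are at most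
δ times the risk, uniformly in w, then a minimizer of the criterion minimizes the loss up to a
factor 1 + O(δ) (`abs_div_iInf_sub_one_le`).

The uniformity rests on the monotonicity of the coefficients. `exists_monotone_majorant` gives one
integrable Z with (∑ α_j x_j)² ≤ (∑ α_j² v_j) Z for all nonnegative monotone α at once, where v
bounds second moments of sums of consecutive x_j. The indices are cut greedily into groups over
which the remaining mass of v halves. In a group, Abel summation reduces matters to partial sums,
and Rademacher–Menshov controls these at the price of a squared logarithm. The number of groups is
at most M, and also at most a constant times one plus a sum of ratios of v to its tails. For the
signal and for the noise this product is dominated by `psi`.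

The first factor ∑ α_j² v_j is at most a constant times n times the risk. It thus suffices that Z is
small relative to n times the optimal risk, which Markov's inequality provides since E Z = O(ψ). Of
the sub-Gaussian property only bounded fourth moments are used. -/

namespace ModelAveraging

/-! ### Maximal inequalities uniform over monotone coefficients -/

/-- Rademacher–Menshov maximal inequality: if the second moments of the block sums of the `x i`
are at most `B ∑ v i`, the squares of all partial sums over an interval of at most `2 ^ K` indices
have a common majorant of expectation at most `(K + 1)² B ∑ v i`. -/
theorem exists_partialSum_majorant {Ω : Type*} [MeasurableSpace Ω] {P : Measure Ω}
    {x : ℕ → Ω → ℝ} {v : ℕ → ℝ} {B : ℝ} {M : ℕ} (hB : 0 ≤ B) (hv : ∀ i, 0 ≤ v i)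
    (hx : ∀ i, MemLp (x i) 2 P)
    (hE : ∀ a b, a ≤ b → b ≤ M →
      ∫ ω, (∑ i ∈ Finset.Ico a b, x i ω) ^ 2 ∂P ≤ B * ∑ i ∈ Finset.Ico a b, v i)
    (K : ℕ) : ∀ a b, a ≤ b → b ≤ a + 2 ^ K → b ≤ M →
      ∃ Z : Ω → ℝ, Integrable Z P ∧ (∀ ω, 0 ≤ Z ω) ∧
        ∫ ω, Z ω ∂P ≤ ((K : ℝ) + 1) ^ 2 * (B * ∑ i ∈ Finset.Ico a b, v i) ∧
        ∀ ω m, a ≤ m → m ≤ b → (∑ i ∈ Finset.Ico a m, x i ω) ^ 2 ≤ Z ω := by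
  have hint : ∀ a b, Integrable (fun ω => (∑ i ∈ Finset.Ico a b, x i ω) ^ 2) P := fun a b =>
    (memLp_finsetSum _ fun i _ => hx i).integrable_sq
  have hVnn : ∀ a b, 0 ≤ B * ∑ i ∈ Finset.Ico a b, v i := fun a b =>
    mul_nonneg hB (Finset.sum_nonneg fun i _ => hv i)
  induction K with
  | zero =>
    intro a b hab hb hbM
    refine ⟨_, hint a b, fun ω => sq_nonneg _, by simpa using hE a b hab hbM, ?_⟩
    intro ω m ham hmb
    rcases eq_or_lt_of_le ham with rfl | h
    · simpa using sq_nonneg _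
    · have : m = b := by simp at hb; omega
      rw [this]
  | succ K ih =>
    intro a b hab hb hbM
    rw [pow_succ] at hb
    set c := min (a + 2 ^ K) b with hc
    have hac : a ≤ c := le_min (by omega) hab
    have hcb : c ≤ b := min_le_right _ _
    obtain ⟨Z₁, hi₁, hn₁, he₁, hm₁⟩ := ih a c hac (min_le_left _ _) (hcb.trans hbM)
    obtain ⟨Z₂, hi₂, hn₂, he₂, hm₂⟩ := ih c b hcb (by omega) hbM
    have hK : (0 : ℝ) < (K : ℝ) + 1 := by positivity
    -- A partial sum running past c is s + t, with s the full left half, and (s + t)² ≤ (1 +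
    -- 1/(K+1)) t² + (K + 2) s². This split of the square is what lets the constant grow only from
    -- (K + 1)² to (K + 2)².
    refine ⟨fun ω => Z₁ ω + (1 + 1 / ((K : ℝ) + 1)) * Z₂ ω
      + ((K : ℝ) + 2) * (∑ i ∈ Finset.Ico a c, x i ω) ^ 2,
      (hi₁.add (hi₂.const_mul _)).add ((hint a c).const_mul _), ?_, ?_, ?_⟩
    · intro ω
      have := hn₁ ω
      have := hn₂ ω
      positivity
    · have hi₁₂ : Integrable (fun ω => Z₁ ω + (1 + 1 / ((K : ℝ) + 1)) * Z₂ ω) P :=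
        hi₁.add (hi₂.const_mul _)
      rw [integral_add hi₁₂ ((hint a c).const_mul _), integral_add hi₁ (hi₂.const_mul _),
        integral_const_mul, integral_const_mul]
      have he₃ := hE a c hac (hcb.trans hbM)
      rw [← Finset.sum_Ico_consecutive v hac hcb, mul_add]
      have h1 := hVnn a c
      have h2 := hVnn c b
      set V₁ := B * ∑ i ∈ Finset.Ico a c, v i
      set V₂ := B * ∑ i ∈ Finset.Ico c b, v i
      have h3 : (1 + 1 / ((K : ℝ) + 1)) * ∫ ω, Z₂ ω ∂P ≤
          (((K : ℝ) + 1) ^ 2 + ((K : ℝ) + 1)) * V₂ := by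
        refine (mul_le_mul_of_nonneg_left he₂ (by positivity)).trans (le_of_eq ?_)
        field_simp
      have h4 := mul_le_mul_of_nonneg_left he₃ (by positivity : (0 : ℝ) ≤ (K : ℝ) + 2)
      push_cast
      nlinarith [mul_nonneg hK.le h1, mul_nonneg hK.le h2]
    · intro ω m ham hmb
      rcases le_total m c with h | h
      · have := hm₁ ω m ham h
        have := hn₂ ω
        have : 0 ≤ (1 + 1 / ((K : ℝ) + 1)) * Z₂ ω
          + ((K : ℝ) + 2) * (∑ i ∈ Finset.Ico a c, x i ω) ^ 2 := by positivity
        linarith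
      · rw [← Finset.sum_Ico_consecutive _ hac h]
        have h2 := hm₂ ω m h hmb
        have h1 := hn₁ ω
        set s := ∑ i ∈ Finset.Ico a c, x i ω
        set t := ∑ i ∈ Finset.Ico c m, x i ω
        have h3 : (1 + 1 / ((K : ℝ) + 1)) * t ^ 2 ≤ (1 + 1 / ((K : ℝ) + 1)) * Z₂ ω :=
          mul_le_mul_of_nonneg_left h2 (by positivity)
        have h4 : (1 + 1 / ((K : ℝ) + 1)) * t ^ 2 + ((K : ℝ) + 2) * s ^ 2 - (s + t) ^ 2
            = (((K : ℝ) + 1) * s - t) ^ 2 / ((K : ℝ) + 1) := by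
          field_simp
          ring
        have h5 : 0 ≤ (((K : ℝ) + 1) * s - t) ^ 2 / ((K : ℝ) + 1) := by positivity
        linarith

/-- Abel summation bound for nonnegative monotone coefficients. -/
theorem abs_sum_mul_sub_le {x α : ℕ → ℝ} {a : ℕ} {T : ℝ} (hα : Monotone α) (hα0 : ∀ i, 0 ≤ α i)
    (hT0 : 0 ≤ T) (b : ℕ) (hab : a ≤ b)
    (hT : ∀ m, a ≤ m → m ≤ b → |∑ i ∈ Finset.Ico a m, x i| ≤ T) :
    ∀ t, 0 ≤ t → (∀ i, a ≤ i → i < b → α i ≤ t) →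
      |∑ i ∈ Finset.Ico a b, α i * x i - t * ∑ i ∈ Finset.Ico a b, x i| ≤ t * T := by
  induction b, hab using Nat.le_induction with
  | base => intro t ht _; simpa using mul_nonneg ht hT0
  | succ m ham ih =>
    intro t _ ht
    -- The step writes the new difference as the old one, taken at t = α m, plus (α m - t) times the
    -- sum up to m + 1. The two bounds α m * T and (t - α m) * T add up to t * T.
    have h1 := ih (fun j h h' => hT j h (h'.trans (Nat.le_succ m))) (α m) (hα0 m)
      (fun i _ h => hα h.le)
    have h2 := hT (m + 1) (by omega) le_rfl
    have h3 := ht m ham (Nat.lt_succ_self m)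
    rw [Finset.sum_Ico_succ_top ham] at h2 ⊢
    rw [Finset.sum_Ico_succ_top ham]
    rw [abs_le] at *
    constructor <;> nlinarith

/-- A form of the Cauchy–Schwarz inequality. -/
theorem add_sq_le_mul {g h A D W Z : ℝ} (hA : 0 ≤ A) (hD : 0 ≤ D) (hW : 0 ≤ W) (hZ : 0 ≤ Z)
    (h1 : g ^ 2 ≤ A * D) (h2 : h ^ 2 ≤ W * Z) : (g + h) ^ 2 ≤ (A + W) * (D + Z) := by
  have h3 : (2 * (g * h)) ^ 2 ≤ (A * Z + W * D) ^ 2 := by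
    have : g ^ 2 * h ^ 2 ≤ (A * D) * (W * Z) := mul_le_mul h1 h2 (sq_nonneg _) (mul_nonneg hA hD)
    nlinarith [sq_nonneg (A * Z - W * D)]
  have h4 := (abs_le_of_sq_le_sq' h3 (add_nonneg (mul_nonneg hA hZ) (mul_nonneg hW hD))).2
  calc (g + h) ^ 2 = g ^ 2 + 2 * (g * h) + h ^ 2 := by ring
    _ ≤ A * D + (A * Z + W * D) + W * Z := add_le_add (add_le_add h1 h4) h2
    _ = (A + W) * (D + Z) := by ring

/-- Induction over groups, from the right. N counts the groups, each of which adds at most 4 (K +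
1)² B to the expectation. A group ending at index c is charged α_c² times the whole mass at its
start a, although v may have little mass near c. More than half of that mass lies at indices from c
on, where the coefficients are at least α_c. The subtracted term 2 α_a² ∑ v is the potential that
pays for the charge without losing a constant factor per group. -/
theorem exists_monotone_majorant_from {Ω : Type*} [MeasurableSpace Ω] {P : Measure Ω}
    {x : ℕ → Ω → ℝ} {v : ℕ → ℝ} {B : ℝ} {M : ℕ} (hB : 0 ≤ B) (hv : ∀ i, 0 ≤ v i)
    (hx : ∀ i, MemLp (x i) 2 P) (hx0 : ∀ i, i < M → v i = 0 → ∀ ω, x i ω = 0)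
    (hE : ∀ a b, a ≤ b → b ≤ M →
      ∫ ω, (∑ i ∈ Finset.Ico a b, x i ω) ^ 2 ∂P ≤ B * ∑ i ∈ Finset.Ico a b, v i)
    {K : ℕ} (hK : M ≤ 2 ^ K) (d : ℕ) : ∀ a, a + d = M →
      ∃ (Z : Ω → ℝ) (N : ℝ), Integrable Z P ∧ (∀ ω, 0 ≤ Z ω) ∧ 0 ≤ N ∧ N ≤ d ∧
        (∑ i ∈ Finset.Ico a M, v i = 0 → N = 0) ∧
        N ≤ 1 + 2 * ∑ j ∈ Finset.Ico (a + 1) M, v (j - 1) / ∑ i ∈ Finset.Ico j M, v i ∧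
        ∫ ω, Z ω ∂P ≤ 4 * ((K : ℝ) + 1) ^ 2 * B * N ∧
        ∀ ω (α : ℕ → ℝ), Monotone α → (∀ i, 0 ≤ α i) →
          (∑ i ∈ Finset.Ico a M, α i * x i ω) ^ 2 ≤
            (4 * ∑ i ∈ Finset.Ico a M, α i ^ 2 * v i
              - 2 * (α a ^ 2 * ∑ i ∈ Finset.Ico a M, v i)) * Z ω := by
  have hs0 : ∀ j, 0 ≤ ∑ i ∈ Finset.Ico j M, v i := fun j => Finset.sum_nonneg fun i _ => hv i
  induction d using Nat.strong_induction_on with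
  | _ d ih =>
  intro a had
  -- Without remaining mass all remaining x vanish, so no group is needed.
  rcases (hs0 a).eq_or_lt with h0 | hpos
  · refine ⟨fun _ => 0, 0, integrable_zero _ _ _, fun _ => le_rfl, le_rfl, Nat.cast_nonneg _,
      fun _ => rfl, ?_, by simp, ?_⟩
    · have : 0 ≤ ∑ j ∈ Finset.Ico (a + 1) M, v (j - 1) / ∑ i ∈ Finset.Ico j M, v i :=
        Finset.sum_nonneg fun j _ => div_nonneg (hv _) (hs0 _)
      linarith
    · intro ω α _ _
      have hz := (Finset.sum_eq_zero_iff_of_nonneg fun i _ => hv i).1 h0.symm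
      rw [Finset.sum_eq_zero fun i hi => ?_]
      · simp
      · rw [hx0 i (Finset.mem_Ico.1 hi).2 (hz i hi), mul_zero]
  · have haM : a < M := by
      by_contra h
      rw [Finset.Ico_eq_empty_of_le (not_lt.1 h)] at hpos
      simp at hpos
    set s : ℕ → ℝ := fun j => ∑ i ∈ Finset.Ico j M, v i with hs
    have hsM : s M ≤ s a / 2 := by
      simpa only [hs, Finset.Ico_self, Finset.sum_empty] using (half_pos hpos).le
    have hex : ∃ b, a < b ∧ s b ≤ s a / 2 := ⟨M, haM, hsM⟩
    classical
    -- The group ends before the first b at which at most half of the mass at a remains. With b = c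
    -- + 1, minimality gives s c > s a / 2.
    obtain ⟨b, ⟨hab, hsb⟩, hbmin⟩ : ∃ b, (a < b ∧ s b ≤ s a / 2) ∧
        ∀ j, j < b → ¬ (a < j ∧ s j ≤ s a / 2) :=
      ⟨Nat.find hex, Nat.find_spec hex, fun j => Nat.find_min hex⟩
    have hbM : b ≤ M := by
      by_contra h
      exact hbmin M (not_le.1 h) ⟨haM, hsM⟩
    obtain ⟨c, rfl⟩ : ∃ c, b = c + 1 := ⟨b - 1, by omega⟩
    have hac : a ≤ c := by omega
    have hsc : s a / 2 < s c := by
      rcases hac.eq_or_lt with rfl | h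
      · exact half_lt_self hpos
      · by_contra h'
        exact hbmin c (Nat.lt_succ_self c) ⟨h, not_lt.1 h'⟩
    have hsplit : ∀ i j, i ≤ j → j ≤ M → ∑ l ∈ Finset.Ico i j, v l = s i - s j := by
      intro i j hij hj
      simp only [hs]
      rw [← Finset.sum_Ico_consecutive v hij hj]
      ring
    obtain ⟨Z, N, hZi, hZ0, hN0, hNd, hNz, hNs, hZe, hZm⟩ :=
      ih (M - (c + 1)) (by omega) (c + 1) (by omega)
    obtain ⟨Z', hZi', hZ0', hZe', hZm'⟩ :=
      exists_partialSum_majorant hB hv hx hE K a (c + 1) hab.le (by omega) hbM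
    rw [hsplit a (c + 1) hab.le hbM] at hZe'
    refine ⟨fun ω => 4 / s a * Z' ω + Z ω, 1 + N, (hZi'.const_mul _).add hZi, ?_, by positivity,
      ?_, ?_, ?_, ?_, ?_⟩
    · intro ω
      have := hZ0' ω
      have := hZ0 ω
      have : 0 ≤ s a := hs0 a
      positivity
    · have : ((M - (c + 1) : ℕ) : ℝ) + 1 ≤ d := by
        have : M - (c + 1) + 1 ≤ d := by omega
        exact_mod_cast this
      linarith
    · intro h
      exact absurd h hpos.ne'
    · have hnn : ∀ j, 0 ≤ v (j - 1) / s j := fun j => div_nonneg (hv _) (hs0 _)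
      -- If no mass is left after the group, it is the last and is paid for by the leading 1.
      -- Otherwise its terms v (j - 1) / s j sum to at least (s a - s (c + 1)) / s a ≥ 1/2, which
      -- the factor 2 turns into one group.
      rcases (hs0 (c + 1)).eq_or_lt with h0 | hbpos
      · rw [hNz h0.symm]
        have := Finset.sum_nonneg fun j (_ : j ∈ Finset.Ico (a + 1) M) => hnn j
        linarith
      · have hcM : c + 1 < M := by
          by_contra h
          rw [Finset.Ico_eq_empty_of_le (not_lt.1 h)] at hbpos
          simp at hbpos
        rw [← Finset.sum_Ico_consecutive _ (by omega : a + 1 ≤ c + 1 + 1)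
          (by omega : c + 1 + 1 ≤ M)]
        have hanti : ∀ i j, i ≤ j → s j ≤ s i := by
          intro i j hij
          exact Finset.sum_le_sum_of_subset_of_nonneg
            (Finset.Ico_subset_Ico_left hij) fun i _ _ => hv i
        have hge : ∑ j ∈ Finset.Ico (a + 1) (c + 1 + 1), v (j - 1) / s a ≤
            ∑ j ∈ Finset.Ico (a + 1) (c + 1 + 1), v (j - 1) / s j := by
          refine Finset.sum_le_sum fun j hj => ?_
          rw [Finset.mem_Ico] at hj
          exact div_le_div_of_nonneg_left (hv _)
            (lt_of_lt_of_le hbpos (hanti j (c + 1) (by omega))) (hanti a j (by omega))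
        rw [← Finset.sum_div, ← Finset.sum_Ico_add' (fun j => v (j - 1)) a (c + 1) 1] at hge
        simp only [Nat.add_sub_cancel] at hge
        rw [hsplit a (c + 1) hab.le hbM] at hge
        have : 1 / 2 ≤ (s a - s (c + 1)) / s a := by
          rw [div_le_div_iff₀ two_pos hpos]
          linarith
        linarith
    · rw [integral_add (hZi'.const_mul _) hZi, integral_const_mul]
      have h1 : 4 / s a * ∫ ω, Z' ω ∂P ≤ 4 * ((K : ℝ) + 1) ^ 2 * B := by
        have hpos' : 0 < s a := hpos
        rw [div_mul_eq_mul_div, div_le_iff₀ hpos']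
        have h2 : 0 ≤ ((K : ℝ) + 1) ^ 2 * B := by positivity
        have h3 : 0 ≤ s (c + 1) := hs0 _
        nlinarith [mul_nonneg h2 h3]
      linarith
    · intro ω α hα hα0
      have hcs := hZm ω α hα hα0
      have hab' := abs_sum_mul_sub_le (x := fun i => x i ω) hα hα0 (Real.sqrt_nonneg (Z' ω))
        (c + 1) hab.le (fun m h h' => Real.abs_le_sqrt (hZm' ω m h h')) (α c) (hα0 c)
        (fun i _ h => hα (by omega))
      have hT := Real.abs_le_sqrt (hZm' ω (c + 1) hab.le le_rfl)
      have hsq := Real.sq_sqrt (hZ0' ω)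
      set T := √(Z' ω)
      have hT0 : 0 ≤ T := Real.sqrt_nonneg _
      rw [← Finset.sum_Ico_consecutive _ hab.le hbM]
      -- One α c * T comes from Abel summation, the other from α c times the full group sum.
      have hg : (∑ i ∈ Finset.Ico a (c + 1), α i * x i ω) ^ 2 ≤ (2 * α c * T) ^ 2 := by
        apply sq_le_sq'
        · rw [abs_le] at hab' hT
          nlinarith [hα0 c]
        · rw [abs_le] at hab' hT
          nlinarith [hα0 c]
      have hQ : α c ^ 2 * (s c - s (c + 1)) + α a ^ 2 * (s a - s c) ≤
          ∑ i ∈ Finset.Ico a (c + 1), α i ^ 2 * v i := by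
        rw [Finset.sum_Ico_succ_top hac, ← hsplit c (c + 1) (by omega) hbM,
          ← hsplit a c hac (by omega), Finset.sum_Ico_succ_top le_rfl]
        simp only [Finset.Ico_self, Finset.sum_empty, zero_add]
        have : α a ^ 2 * ∑ i ∈ Finset.Ico a c, v i ≤ ∑ i ∈ Finset.Ico a c, α i ^ 2 * v i := by
          rw [Finset.mul_sum]
          refine Finset.sum_le_sum fun i hi => ?_
          exact mul_le_mul_of_nonneg_right
            (pow_le_pow_left₀ (hα0 a) (hα (Finset.mem_Ico.1 hi).1) 2) (hv i)
        linarith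
      -- The potential inequality: after inserting `hQ` and `h5`, the slack is exactly the sum of
      -- the two products in `h6` and `h7`. These are nonnegative because s c > s a / 2 and s (c +
      -- 1) ≤ s a / 2.
      have hW : α c ^ 2 * s a + (4 * ∑ i ∈ Finset.Ico (c + 1) M, α i ^ 2 * v i
              - 2 * (α (c + 1) ^ 2 * s (c + 1))) ≤ 4 * (∑ i ∈ Finset.Ico a (c + 1), α i ^ 2 * v i
                + ∑ i ∈ Finset.Ico (c + 1) M, α i ^ 2 * v i) - 2 * (α a ^ 2 * s a) := by
        have h1 : α c ^ 2 ≤ α (c + 1) ^ 2 := pow_le_pow_left₀ (hα0 c) (hα (by omega)) 2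
        have h2 : α a ^ 2 ≤ α c ^ 2 := pow_le_pow_left₀ (hα0 a) (hα hac) 2
        have h3 : 0 ≤ s (c + 1) := hs0 _
        have h4 : 0 ≤ α a ^ 2 := sq_nonneg _
        have h5 := mul_le_mul_of_nonneg_right h1 h3
        have h6 : 0 ≤ (α c ^ 2 - α a ^ 2) * (4 * s c - 2 * s a) :=
          mul_nonneg (by linarith) (by linarith)
        have h7 : 0 ≤ α c ^ 2 * (s a - 2 * s (c + 1)) := mul_nonneg (sq_nonneg _) (by linarith)
        nlinarith
      rw [← Finset.sum_Ico_consecutive (fun i => α i ^ 2 * v i) hab.le hbM]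
      have hZn : 0 ≤ 4 / s a * Z' ω + Z ω := by
        have := hZ0' ω
        have := hZ0 ω
        have : 0 ≤ s a := hs0 a
        positivity
      refine le_trans ?_ (mul_le_mul_of_nonneg_right hW hZn)
      set W := 4 * ∑ i ∈ Finset.Ico (c + 1) M, α i ^ 2 * v i - 2 * (α (c + 1) ^ 2 * s (c + 1))
      have hW0 : 0 ≤ W := by
        have h1 : ∑ i ∈ Finset.Ico (c + 1) M, α (c + 1) ^ 2 * v i ≤
            ∑ i ∈ Finset.Ico (c + 1) M, α i ^ 2 * v i :=
          Finset.sum_le_sum fun i hi => mul_le_mul_of_nonneg_right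
            (pow_le_pow_left₀ (hα0 _) (hα (Finset.mem_Ico.1 hi).1) 2) (hv i)
        rw [← Finset.mul_sum] at h1
        have h2 : 0 ≤ α (c + 1) ^ 2 * s (c + 1) := mul_nonneg (sq_nonneg _) (hs0 _)
        simp only [W, hs] at h2 ⊢
        linarith
      set g := ∑ i ∈ Finset.Ico a (c + 1), α i * x i ω
      set h := ∑ i ∈ Finset.Ico (c + 1) M, α i * x i ω
      have hpos' : 0 < s a := hpos
      have e1 : g ^ 2 ≤ (α c ^ 2 * s a) * (4 / s a * Z' ω) := by
        refine hg.trans (le_of_eq ?_)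
        rw [← hsq]
        field_simp
        ring
      have e2 : h ^ 2 ≤ W * Z ω := hcs
      have hp1 : 0 ≤ α c ^ 2 * s a := by positivity
      have hp2 : 0 ≤ 4 / s a * Z' ω := by have := hZ0' ω; positivity
      exact add_sq_le_mul hp1 hp2 hW0 (hZ0 ω) e1 e2

/-- Uniform control of all linear combinations with nonnegative monotone coefficients. -/
theorem exists_monotone_majorant {Ω : Type*} [MeasurableSpace Ω] {P : Measure Ω}
    {x : ℕ → Ω → ℝ} {v : ℕ → ℝ} {B : ℝ} {M : ℕ} (hM : 1 ≤ M) (hB : 0 ≤ B) (hv : ∀ i, 0 ≤ v i)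
    (hx : ∀ i, MemLp (x i) 2 P) (hx0 : ∀ i, i < M → v i = 0 → ∀ ω, x i ω = 0)
    (hE : ∀ a b, a ≤ b → b ≤ M →
      ∫ ω, (∑ i ∈ Finset.Ico a b, x i ω) ^ 2 ∂P ≤ B * ∑ i ∈ Finset.Ico a b, v i) :
    ∃ Z : Ω → ℝ, Integrable Z P ∧ (∀ ω, 0 ≤ Z ω) ∧
      ∫ ω, Z ω ∂P ≤ 512 * B * (min (M : ℝ) (1 + ∑ j ∈ Finset.Ico 1 M,
        v (j - 1) / (4 * ∑ i ∈ Finset.Ico j M, v i)) * (1 + Real.log M) ^ 2) ∧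
      ∀ ω (α : ℕ → ℝ), Monotone α → (∀ i, 0 ≤ α i) →
        (∑ i ∈ Finset.range M, α i * x i ω) ^ 2 ≤
          (∑ i ∈ Finset.range M, α i ^ 2 * v i) * Z ω := by
  obtain ⟨Z, N, hZi, hZ0, hN0, hNd, -, hNs, hZe, hZm⟩ :=
    exists_monotone_majorant_from hB hv hx hx0 hE (Nat.le_pow_clog one_lt_two M) M 0 (zero_add M)
  -- The constant is 512 = 4 · 4 · 4 · 8: the factor here, the one in the expectation of Z, the one
  -- from (K + 1)² ≤ 4 (1 + log M)², and the one from the bound on N.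
  refine ⟨fun ω => 4 * Z ω, hZi.const_mul _, fun ω => by have := hZ0 ω; positivity, ?_, ?_⟩
  · rw [integral_const_mul]
    have hlog : 0 ≤ Real.log M := Real.log_natCast_nonneg M
    have hK : (Nat.clog 2 M : ℝ) + 1 ≤ 2 * (1 + Real.log M) := by
      rcases hM.eq_or_lt with rfl | h
      · simp
      · have h1 : 2 ^ (Nat.clog 2 M - 1) < M := Nat.pow_pred_clog_lt_self one_lt_two h
        have h2 : ((Nat.clog 2 M - 1 : ℕ) : ℝ) * Real.log 2 ≤ Real.log M := by
          rw [← Real.log_pow]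
          exact Real.log_le_log (by positivity) (by exact_mod_cast h1.le)
        have h3 : 1 ≤ Nat.clog 2 M := Nat.clog_pos one_lt_two h
        rw [Nat.cast_sub h3] at h2
        have h4 := Real.log_two_gt_d9
        have h5 : (1 : ℝ) ≤ Nat.clog 2 M := by exact_mod_cast h3
        push_cast at h2
        nlinarith
    have hK2 : ((Nat.clog 2 M : ℝ) + 1) ^ 2 ≤ 4 * (1 + Real.log M) ^ 2 := by
      have := pow_le_pow_left₀ (by positivity) hK 2
      linarith
    have hNm : N ≤ 8 * min (M : ℝ) (1 + ∑ j ∈ Finset.Ico 1 M,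
        v (j - 1) / (4 * ∑ i ∈ Finset.Ico j M, v i)) := by
      rw [mul_min_of_nonneg _ _ (by norm_num : (0 : ℝ) ≤ 8)]
      refine le_min (by linarith) ?_
      have : ∀ j, v (j - 1) / (4 * ∑ i ∈ Finset.Ico j M, v i)
          = 4⁻¹ * (v (j - 1) / ∑ i ∈ Finset.Ico j M, v i) := by
        intro j
        rw [mul_comm 4, ← div_div, div_eq_inv_mul _ 4]
      simp only [this]
      rw [← Finset.mul_sum]
      simp only [zero_add] at hNs
      linarith
    have h6 : ((Nat.clog 2 M : ℝ) + 1) ^ 2 * N ≤ (4 * (1 + Real.log M) ^ 2) *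
        (8 * min (M : ℝ) (1 + ∑ j ∈ Finset.Ico 1 M,
          v (j - 1) / (4 * ∑ i ∈ Finset.Ico j M, v i))) :=
      mul_le_mul hK2 hNm hN0 (by positivity)
    have h7 := mul_le_mul_of_nonneg_left h6 hB
    linarith
  · intro ω α hα hα0
    have h := hZm ω α hα hα0
    rw [← Finset.range_eq_Ico] at h
    refine h.trans ?_
    have : 0 ≤ α 0 ^ 2 * ∑ i ∈ Finset.range M, v i :=
      mul_nonneg (sq_nonneg _) (Finset.sum_nonneg fun i _ => hv i)
    nlinarith [mul_nonneg this (hZ0 ω)]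

/-! ### Second moments of linear and quadratic forms in the errors -/

/-- A function of the variables with indices in `s` is independent of a variable with another
index. -/
theorem indepFun_of_notMem {Ω ι : Type*} [MeasurableSpace Ω] {P : Measure Ω}
    {ε : ι → Ω → ℝ} (hind : iIndepFun ε P) (hm : ∀ i, AEMeasurable (ε i) P) {s : Finset ι} {a : ι}
    (ha : a ∉ s) {G : (ι → ℝ) → ℝ} (hG : Measurable G)
    (hGs : ∀ u u' : ι → ℝ, (∀ i ∈ s, u i = u' i) → G u = G u') :
    IndepFun (fun ω => G fun i => ε i ω) (ε a) P := by
  classical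
  have h := hind.indepFun_finset₀ s {a} (Finset.disjoint_singleton_right.2 ha) hm
  have hext : Measurable fun (u : s → ℝ) (i : ι) => if h : i ∈ s then u ⟨i, h⟩ else 0 := by
    refine measurable_pi_lambda _ fun i => ?_
    by_cases hi : i ∈ s
    · simpa [hi] using measurable_pi_apply _
    · simp [hi]
  have h' := h.comp (hG.comp hext)
    (measurable_pi_apply (⟨a, Finset.mem_singleton_self a⟩ : ({a} : Finset ι)))
  refine (funext fun ω => ?_ : (fun ω => G fun i => ε i ω) = _) ▸ h'
  exact hGs _ _ fun i hi => by simp [hi]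

section SecondMoments

variable {Ω ι : Type*} [MeasurableSpace Ω] {P : Measure Ω}
  {ε : ι → Ω → ℝ} {σ κ : ℝ}

theorem integral_mul_of_ne (hind : iIndepFun ε P) (hL : ∀ i, MemLp (ε i) 4 P)
    (hmean : ∀ i, ∫ ω, ε i ω ∂P = 0) {i j : ι} (hij : i ≠ j) : ∫ ω, ε i ω * ε j ω ∂P = 0 := by
  rw [(hind.indepFun hij).integral_fun_mul_eq_mul_integral (hL i).1 (hL j).1, hmean, zero_mul]

theorem memLp_mul_two {f g : Ω → ℝ} (hf : MemLp f 4 P) (hg : MemLp g 4 P) :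
    MemLp (fun ω => f ω * g ω) 2 P := by
  have : ENNReal.HolderTriple 4 4 2 := ⟨by
    rw [← two_mul]
    have : (4 : ENNReal) = 2 * 2 := by norm_num
    rw [this, ENNReal.mul_inv (by simp) (by simp), ← mul_assoc, ENNReal.mul_inv_cancel (by simp)
      (by simp), one_mul]⟩
  exact hg.mul' hf

theorem integral_sq_linearForm [IsProbabilityMeasure P] (hind : iIndepFun ε P) (hL : ∀ i, MemLp (ε i) 4 P)
    (hmean : ∀ i, ∫ ω, ε i ω ∂P = 0) (hvar : ∀ i, ∫ ω, ε i ω ^ 2 ∂P = σ ^ 2)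
    (s : Finset ι) (c : ι → ℝ) :
    ∫ ω, (∑ i ∈ s, c i * ε i ω) ^ 2 ∂P = σ ^ 2 * ∑ i ∈ s, c i ^ 2 := by
  classical
  have hint : ∀ i j, Integrable (fun ω => c i * c j * (ε i ω * ε j ω)) P := fun i j =>
    ((memLp_mul_two (hL i) (hL j)).integrable one_le_two).const_mul _
  have h1 : ∀ ω, (∑ i ∈ s, c i * ε i ω) ^ 2 = ∑ i ∈ s, ∑ j ∈ s, c i * c j * (ε i ω * ε j ω) := by
    intro ω
    rw [sq, Finset.sum_mul_sum]
    exact Finset.sum_congr rfl fun i _ => Finset.sum_congr rfl fun j _ => by ring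
  simp only [h1]
  rw [integral_finsetSum _ fun i _ => integrable_finsetSum _ fun j _ => hint i j, Finset.mul_sum]
  refine Finset.sum_congr rfl fun i hi => ?_
  rw [integral_finsetSum _ fun j _ => hint i j, Finset.sum_eq_single i]
  · rw [integral_const_mul]
    simp only [← sq]
    rw [hvar]
    ring
  · intro j _ hj
    rw [integral_const_mul, integral_mul_of_ne hind hL hmean hj.symm, mul_zero]
  · exact fun h => absurd hi h

/-- Second moment of a centred quadratic form in independent variables. -/
theorem integral_sq_quadraticForm_le [IsProbabilityMeasure P] [DecidableEq ι] (hind : iIndepFun ε P)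
    (hL : ∀ i, MemLp (ε i) 4 P)
    (hmean : ∀ i, ∫ ω, ε i ω ∂P = 0) (hvar : ∀ i, ∫ ω, ε i ω ^ 2 ∂P = σ ^ 2)
    (hκ : ∀ i, ∫ ω, (ε i ω ^ 2 - σ ^ 2) ^ 2 ∂P ≤ κ) (A : ι → ι → ℝ) (hA : ∀ i j, A i j = A j i)
    (s : Finset ι) :
    ∫ ω, (∑ i ∈ s, ∑ j ∈ s, A i j * (ε i ω * ε j ω - if i = j then σ ^ 2 else 0)) ^ 2 ∂P ≤
      (2 * κ + 4 * σ ^ 4) * ∑ i ∈ s, ∑ j ∈ s, A i j ^ 2 := by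
  have hL2 : ∀ i, MemLp (ε i) 2 P := fun i => (hL i).mono_exponent (by norm_num)
  have hmeas : ∀ i, AEMeasurable (ε i) P := fun i => (hL i).1.aemeasurable
  have hprod : ∀ i j, MemLp (fun ω => ε i ω * ε j ω - if i = j then σ ^ 2 else 0) 2 P := fun i j =>
    (memLp_mul_two (hL i) (hL j)).sub (memLp_const _)
  have hTL : ∀ s : Finset ι, MemLp (fun ω => ∑ i ∈ s, ∑ j ∈ s,
      A i j * (ε i ω * ε j ω - if i = j then σ ^ 2 else 0)) 2 P := fun s =>
    memLp_finsetSum _ fun i _ => memLp_finsetSum _ fun j _ => (hprod i j).const_mul _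
  induction s using Finset.induction_on with
  | empty => simp
  | insert a s ha ih =>
    set T : Ω → ℝ := fun ω => ∑ i ∈ s, ∑ j ∈ s,
      A i j * (ε i ω * ε j ω - if i = j then σ ^ 2 else 0) with hT
    set V : Ω → ℝ := fun ω => ∑ j ∈ s, A a j * ε j ω with hV
    have hκ0 : 0 ≤ κ := (integral_nonneg fun ω => sq_nonneg _).trans (hκ a)
    have hVL : MemLp V 4 P := memLp_finsetSum _ fun j _ => (hL j).const_mul _
    have hVL2 : MemLp V 2 P := hVL.mono_exponent (by norm_num)
    have hDL : MemLp (fun ω => ε a ω ^ 2 - σ ^ 2) 2 P := by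
      have := hprod a a
      simpa [← sq] using this
    -- Adjoining an index adds a martingale increment: T and V involve only the earlier variables,
    -- so both products of T with the increment have mean zero.
    have hdec : ∀ ω, ∑ i ∈ insert a s, ∑ j ∈ insert a s,
        A i j * (ε i ω * ε j ω - if i = j then σ ^ 2 else 0) =
        T ω + (A a a * (ε a ω ^ 2 - σ ^ 2) + 2 * (V ω * ε a ω)) := by
      intro ω
      have h1 : ∀ i ∈ s, (if i = a then σ ^ 2 else 0) = 0 := fun i hi =>
        if_neg fun (h : i = a) => ha (h ▸ hi)
      have h2 : ∀ i ∈ s, (if a = i then σ ^ 2 else 0) = 0 := fun i hi =>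
        if_neg fun (h : a = i) => ha (h ▸ hi)
      rw [Finset.sum_insert ha, Finset.sum_insert ha]
      have h3 : ∑ i ∈ s, ∑ j ∈ insert a s,
          A i j * (ε i ω * ε j ω - if i = j then σ ^ 2 else 0) = V ω * ε a ω + T ω := by
        simp only [hT, hV]
        rw [Finset.sum_mul, ← Finset.sum_add_distrib]
        refine Finset.sum_congr rfl fun i hi => ?_
        rw [Finset.sum_insert ha, h1 i hi, hA i a]
        ring
      have h4 : ∑ j ∈ s, A a j * (ε a ω * ε j ω - if a = j then σ ^ 2 else 0) = V ω * ε a ω := by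
        simp only [hV]
        rw [Finset.sum_mul]
        refine Finset.sum_congr rfl fun i hi => ?_
        rw [h2 i hi]
        ring
      rw [h3, h4, if_pos rfl]
      ring
    have hTind : IndepFun T (ε a) P := by
      refine indepFun_of_notMem hind hmeas ha (G := fun u => ∑ i ∈ s, ∑ j ∈ s,
        A i j * (u i * u j - if i = j then σ ^ 2 else 0)) (by fun_prop) fun u u' h => ?_
      exact Finset.sum_congr rfl fun i hi => Finset.sum_congr rfl fun j hj => by
        rw [h i hi, h j hj]
    have hVind : IndepFun V (ε a) P := by
      refine indepFun_of_notMem hind hmeas ha (G := fun u => ∑ j ∈ s, A a j * u j)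
        (by fun_prop) fun u u' h => ?_
      exact Finset.sum_congr rfl fun j hj => by rw [h j hj]
    have hTVind : IndepFun (fun ω => T ω * V ω) (ε a) P := by
      refine indepFun_of_notMem hind hmeas ha (G := fun u => (∑ i ∈ s, ∑ j ∈ s,
        A i j * (u i * u j - if i = j then σ ^ 2 else 0)) * ∑ j ∈ s, A a j * u j)
        (by fun_prop) fun u u' h => ?_
      congr 1
      · exact Finset.sum_congr rfl fun i hi => Finset.sum_congr rfl fun j hj => by
          rw [h i hi, h j hj]
      · exact Finset.sum_congr rfl fun j hj => by rw [h j hj]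
    have hTDind : IndepFun T (fun ω => ε a ω ^ 2 - σ ^ 2) P :=
      hTind.comp measurable_id (by fun_prop : Measurable fun t : ℝ => t ^ 2 - σ ^ 2)
    have hV2ind : IndepFun (fun ω => V ω ^ 2) (fun ω => ε a ω ^ 2) P :=
      hVind.comp (by fun_prop : Measurable fun t : ℝ => t ^ 2)
        (by fun_prop : Measurable fun t : ℝ => t ^ 2)
    have hTVint : Integrable (fun ω => T ω * V ω) P := (hTL s).integrable_mul hVL2
    have hi1 : Integrable (fun ω => T ω ^ 2) P := (hTL s).integrable_sq
    have hi2 : Integrable (fun ω => T ω * (ε a ω ^ 2 - σ ^ 2)) P := (hTL s).integrable_mul hDL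
    have hi3 : Integrable (fun ω => T ω * V ω * ε a ω) P :=
      hTVind.integrable_mul hTVint ((hL2 a).integrable one_le_two)
    have hi4 : Integrable (fun ω => (ε a ω ^ 2 - σ ^ 2) ^ 2) P := hDL.integrable_sq
    have hi5 : Integrable (fun ω => V ω ^ 2 * ε a ω ^ 2) P :=
      hV2ind.integrable_mul hVL2.integrable_sq (hL2 a).integrable_sq
    have he2 : ∫ ω, T ω * (ε a ω ^ 2 - σ ^ 2) ∂P = 0 := by
      rw [hTDind.integral_fun_mul_eq_mul_integral (hTL s).1 hDL.1,
        integral_sub (hL2 a).integrable_sq (integrable_const _), hvar]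
      simp
    have he3 : ∫ ω, T ω * V ω * ε a ω ∂P = 0 := by
      rw [hTVind.integral_fun_mul_eq_mul_integral hTVint.1 (hL2 a).1, hmean, mul_zero]
    have he5 : ∫ ω, V ω ^ 2 * ε a ω ^ 2 ∂P = σ ^ 4 * ∑ j ∈ s, A a j ^ 2 := by
      rw [hV2ind.integral_fun_mul_eq_mul_integral hVL2.integrable_sq.1 (hL2 a).integrable_sq.1,
        hvar, integral_sq_linearForm hind hL hmean hvar]
      ring
    have hsum : ∑ i ∈ insert a s, ∑ j ∈ insert a s, A i j ^ 2 =
        ∑ i ∈ s, ∑ j ∈ s, A i j ^ 2 + (A a a ^ 2 + 2 * ∑ j ∈ s, A a j ^ 2) := by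
      rw [Finset.sum_insert ha, Finset.sum_insert ha]
      have : ∑ i ∈ s, ∑ j ∈ insert a s, A i j ^ 2 =
          ∑ j ∈ s, A a j ^ 2 + ∑ i ∈ s, ∑ j ∈ s, A i j ^ 2 := by
        rw [← Finset.sum_add_distrib]
        refine Finset.sum_congr rfl fun i _ => ?_
        rw [Finset.sum_insert ha, hA i a]
      rw [this]
      ring
    -- The square of the increment is bounded by twice the sum of squares. In expectation this is 2κ
    -- A_aa² + 8σ⁴ ∑ A_aj², while the squared Frobenius norm gains A_aa² + 2 ∑ A_aj². Hence the
    -- constant 2κ + 4σ⁴.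
    have hbound : ∀ ω, (∑ i ∈ insert a s, ∑ j ∈ insert a s,
        A i j * (ε i ω * ε j ω - if i = j then σ ^ 2 else 0)) ^ 2 ≤
        T ω ^ 2 + 2 * A a a * (T ω * (ε a ω ^ 2 - σ ^ 2)) + 4 * (T ω * V ω * ε a ω)
          + 2 * A a a ^ 2 * (ε a ω ^ 2 - σ ^ 2) ^ 2 + 8 * (V ω ^ 2 * ε a ω ^ 2) := by
      intro ω
      rw [hdec]
      nlinarith [sq_nonneg (A a a * (ε a ω ^ 2 - σ ^ 2) - 2 * (V ω * ε a ω))]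
    have hj2 := hi1.add (hi2.const_mul (2 * A a a))
    have hj3 := hj2.add (hi3.const_mul 4)
    have hj4 := hj3.add (hi4.const_mul (2 * A a a ^ 2))
    have hj5 := hj4.add (hi5.const_mul 8)
    refine (integral_mono (hTL (insert a s)).integrable_sq hj5 hbound).trans ?_
    have hval : ∫ ω, (T ω ^ 2 + 2 * A a a * (T ω * (ε a ω ^ 2 - σ ^ 2)) + 4 * (T ω * V ω * ε a ω)
          + 2 * A a a ^ 2 * (ε a ω ^ 2 - σ ^ 2) ^ 2 + 8 * (V ω ^ 2 * ε a ω ^ 2)) ∂P =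
        ∫ ω, T ω ^ 2 ∂P + 2 * A a a ^ 2 * ∫ ω, (ε a ω ^ 2 - σ ^ 2) ^ 2 ∂P
          + 8 * (σ ^ 4 * ∑ j ∈ s, A a j ^ 2) := by
      refine (integral_add hj4 (hi5.const_mul 8)).trans ?_
      rw [integral_const_mul, he5]
      congr 1
      refine (integral_add hj3 (hi4.const_mul (2 * A a a ^ 2))).trans ?_
      rw [integral_const_mul]
      congr 1
      refine (integral_add hj2 (hi3.const_mul 4)).trans ?_
      rw [integral_const_mul, he3, mul_zero, add_zero]
      refine (integral_add hi1 (hi2.const_mul (2 * A a a))).trans ?_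
      rw [integral_const_mul, he2, mul_zero, add_zero]
    refine hval.le.trans ?_
    rw [hsum]
    have h1 := mul_le_mul_of_nonneg_left (hκ a) (by positivity : 0 ≤ 2 * A a a ^ 2)
    have h2 : 0 ≤ ∑ j ∈ s, A a j ^ 2 := Finset.sum_nonneg fun j _ => sq_nonneg _
    have h3 : 0 ≤ σ ^ 4 * A a a ^ 2 := by positivity
    have h4 : 0 ≤ κ * ∑ j ∈ s, A a j ^ 2 := mul_nonneg hκ0 h2
    linarith

/-- The variance of the square of a sub-Gaussian variable is bounded in terms of its parameter. -/
theorem integral_sq_sub_sq_le [IsProbabilityMeasure P] {X : Ω → ℝ} {c : ℝ≥0} (hX : HasSubgaussianMGF X c P) (σ : ℝ) :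
    ∫ ω, (X ω ^ 2 - σ ^ 2) ^ 2 ∂P ≤ 48 * Real.exp (c / 2) + σ ^ 4 := by
  have h4 : MemLp X 4 P := hX.memLp 4
  have h1 := hX.integrable_exp_mul 1
  have h2 := hX.integrable_exp_mul (-1)
  have hm1 := hX.mgf_le 1
  have hm2 := hX.mgf_le (-1)
  simp only [mgf] at hm1 hm2
  have hL : MemLp (fun ω => X ω ^ 2 - σ ^ 2) 2 P := by
    have := (memLp_mul_two h4 h4).sub (memLp_const (σ ^ 2) (μ := P))
    simpa [← sq, Pi.sub_def] using this
  -- From x⁴ ≤ 4! exp |x| and exp |x| ≤ exp x + exp (-x). The two moment generating function values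
  -- at ±1 then give 48 = 2 · 24.
  have hle : ∀ ω, (X ω ^ 2 - σ ^ 2) ^ 2 ≤
      24 * (Real.exp (1 * X ω) + Real.exp (-1 * X ω)) + σ ^ 4 := by
    intro ω
    have h := Real.pow_div_factorial_le_exp _ (abs_nonneg (X ω)) 4
    have hf : (Nat.factorial 4 : ℝ) = 24 := by norm_num [Nat.factorial]
    rw [hf, div_le_iff₀ (by norm_num)] at h
    have hp : |X ω| ^ 4 = X ω ^ 4 := by
      rw [show (4 : ℕ) = 2 * 2 from rfl, pow_mul, sq_abs, pow_mul]
    have he : Real.exp |X ω| ≤ Real.exp (1 * X ω) + Real.exp (-1 * X ω) := by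
      rcases abs_choice (X ω) with h | h <;> rw [h]
      · rw [one_mul]; linarith [Real.exp_pos (-1 * X ω)]
      · rw [neg_one_mul]; linarith [Real.exp_pos (1 * X ω)]
    nlinarith [mul_nonneg (sq_nonneg (X ω)) (sq_nonneg σ)]
  refine (integral_mono hL.integrable_sq (((h1.add h2).const_mul 24).add (integrable_const _))
    hle).trans ?_
  have : ∫ ω, (24 * (Real.exp (1 * X ω) + Real.exp (-1 * X ω)) + σ ^ 4) ∂P =
      24 * (∫ ω, Real.exp (1 * X ω) ∂P + ∫ ω, Real.exp (-1 * X ω) ∂P) + σ ^ 4 := by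
    refine (integral_add ((h1.add h2).const_mul 24) (integrable_const _)).trans ?_
    rw [integral_const_mul]
    congr 1
    · congr 1
      exact integral_add h1 h2
    · simp
  refine this.le.trans ?_
  norm_num at hm1 hm2
  norm_num
  linarith

end SecondMoments

/-! ### Squared norms and the orthonormalized regressors -/

theorem sqNorm_eq_dotProduct {n : ℕ} (v : Fin n → ℝ) : sqNorm v = v ⬝ᵥ v :=
  Finset.sum_congr rfl fun i _ => sq (v i)

theorem sqNorm_nonneg {n : ℕ} (v : Fin n → ℝ) : 0 ≤ sqNorm v :=
  Finset.sum_nonneg fun i _ => sq_nonneg (v i)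

theorem sqNorm_sub {n : ℕ} (u v : Fin n → ℝ) :
    sqNorm (u - v) = sqNorm u - 2 * (u ⬝ᵥ v) + sqNorm v := by
  simp only [sqNorm_eq_dotProduct, sub_dotProduct, dotProduct_sub, dotProduct_comm v u]
  ring

section Phi

variable {n p : ℕ} {X : Matrix (Fin n) (Fin p) ℝ}

theorem phi_dotProduct_phi_eq_ite (hX : X.rank = p) (i j : Fin p) :
    phi X i ⬝ᵥ phi X j = if i = j then 1 else 0 := by
  split_ifs with h
  · rw [h, phi_dotProduct_phi X hX]
  · have hle : LinearIndependent ℝ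
        (fun l : Fin p => (WithLp.toLp 2 (X.col l) : EuclideanSpace ℝ (Fin n))) :=
      (linearIndependent_col X hX).map' (WithLp.linearEquiv 2 ℝ (Fin n → ℝ)).symm.toLinearMap
        (LinearEquiv.ker _)
    have h2 := (InnerProductSpace.gramSchmidtNormed_orthonormal hle).2 (Ne.symm h)
    beta_reduce at h2
    rw [EuclideanSpace.inner_eq_star_dotProduct] at h2
    exact h2

theorem sum_smul_phi_dotProduct_sum_smul_phi (hX : X.rank = p) (s : Finset (Fin p)) (c : Fin p → ℝ) :
    (∑ l ∈ s, c l • phi X l) ⬝ᵥ (∑ l ∈ s, c l • phi X l) = ∑ l ∈ s, c l ^ 2 := by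
  rw [sum_dotProduct]
  refine Finset.sum_congr rfl fun i hi => ?_
  rw [dotProduct_sum, Finset.sum_eq_single i]
  · rw [smul_dotProduct, dotProduct_smul, phi_dotProduct_phi X hX]
    simp [sq]
  · intro j _ hj
    rw [smul_dotProduct, dotProduct_smul, phi_dotProduct_phi_eq_ite hX, if_neg hj.symm]
    simp
  · exact fun h => absurd hi h

/-- Bessel's inequality. -/
theorem sum_sq_phi_dotProduct_le (hX : X.rank = p) (s : Finset (Fin p)) (f : Fin n → ℝ) :
    ∑ l ∈ s, (phi X l ⬝ᵥ f) ^ 2 ≤ sqNorm f := by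
  have h := sqNorm_nonneg (f - ∑ l ∈ s, (phi X l ⬝ᵥ f) • phi X l)
  rw [sqNorm_sub, sqNorm_eq_dotProduct (∑ l ∈ s, _),
    sum_smul_phi_dotProduct_sum_smul_phi hX, dotProduct_sum] at h
  have h2 : ∑ l ∈ s, f ⬝ᵥ ((phi X l ⬝ᵥ f) • phi X l) = ∑ l ∈ s, (phi X l ⬝ᵥ f) ^ 2 :=
    Finset.sum_congr rfl fun l _ => by rw [dotProduct_smul, dotProduct_comm f, smul_eq_mul, sq]
  rw [h2] at h
  linarith

/-- Telescoping the rank-one differences `hatMatrix_sub_hatMatrix`. -/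
theorem hatMatrix_initialModel_mulVec (hX : X.rank = p) (y : Fin n → ℝ) (r : ℕ) (hr : r ≤ p) :
    hatMatrix X (initialModel p r) *ᵥ y =
      ∑ l ∈ initialModel p r, (phi X l ⬝ᵥ y) • phi X l := by
  induction r with
  | zero =>
    have h0 : initialModel p 0 = ∅ := by simp [initialModel]
    rw [h0, Finset.sum_empty]
    have : hatMatrix X ∅ = 0 := by
      ext i j
      simp [hatMatrix, Matrix.mul_apply]
    rw [this, Matrix.zero_mulVec]
  | succ r ih =>
    have hj := hatMatrix_sub_hatMatrix X hX ⟨r, hr⟩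
    have hins : initialModel p (r + 1) = insert ⟨r, hr⟩ (initialModel p r) := by
      ext l
      simp only [initialModel, Finset.mem_filter, Finset.mem_univ, true_and, Finset.mem_insert,
        Fin.ext_iff]
      omega
    rw [sub_eq_iff_eq_add] at hj
    simp only at hj
    rw [hj, Matrix.add_mulVec, ih (by omega), hins,
      Finset.sum_insert (by simp [initialModel])]
    congr 1
    ext i
    simp only [Matrix.mulVec, Matrix.vecMulVec_apply, dotProduct, Pi.smul_apply, smul_eq_mul,
      Finset.sum_mul]
    exact Finset.sum_congr rfl fun _ _ => by ring

end Phi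

/-! ### Blocks of regressors and cumulative weights -/

/-- The regressors number `a + 1, …, b`. -/
def regressors (p a b : ℕ) : Finset (Fin p) :=
  Finset.univ.filter fun l => a ≤ (l : ℕ) ∧ (l : ℕ) < b

theorem card_regressors {p a b : ℕ} (hb : b ≤ p) : (regressors p a b).card = b - a := by
  rw [← Nat.card_Ico, ← Finset.card_map Fin.valEmbedding]
  congr 1
  ext i
  simp only [regressors, Finset.mem_map, Finset.mem_filter, Finset.mem_univ, true_and,
    Fin.valEmbedding_apply, Finset.mem_Ico]
  constructor
  · rintro ⟨l, hl, rfl⟩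
    exact hl
  · exact fun h => ⟨⟨i, by omega⟩, h, rfl⟩

theorem sum_sum_regressors {E : Type*} [AddCommMonoid E] {p M : ℕ} {k : ℕ → ℕ}
    (hk : StrictMonoOn k (Set.Icc 0 M))
    (h : Fin p → E) {a b : ℕ} (hab : a ≤ b) (hb : b ≤ M) :
    ∑ j ∈ Finset.Ico a b, ∑ l ∈ regressors p (k j) (k (j + 1)), h l =
      ∑ l ∈ regressors p (k a) (k b), h l := by
  induction b, hab using Nat.le_induction with
  | base =>
    have : regressors p (k a) (k a) = ∅ := by
      ext l
      simp [regressors]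
    rw [this]
    simp
  | succ b hab ih =>
    have h1 : k a ≤ k b := hk.monotoneOn ⟨by omega, by omega⟩ ⟨by omega, by omega⟩ hab
    have h2 : k b ≤ k (b + 1) :=
      hk.monotoneOn ⟨by omega, by omega⟩ ⟨by omega, by omega⟩ (Nat.le_succ b)
    rw [Finset.sum_Ico_succ_top hab, ih (by omega), ← Finset.sum_union]
    · congr 1
      ext l
      simp only [regressors, Finset.mem_union, Finset.mem_filter, Finset.mem_univ, true_and]
      omega
    · rw [Finset.disjoint_left]
      intro l
      simp only [regressors, Finset.mem_filter, Finset.mem_univ, true_and]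
      omega

/-- The cumulative weight of the models with index at least `j`. -/
noncomputable def cumWeight {M : ℕ} (w : Fin M → ℝ) (j : ℕ) : ℝ := ∑ m : Fin M, if j ≤ (m : ℕ) then w m else 0

theorem cumWeight_antitone {M : ℕ} {w : Fin M → ℝ} (hw : w ∈ stdSimplex ℝ (Fin M)) :
    Antitone (cumWeight w) := by
  intro i j hij
  refine Finset.sum_le_sum fun m _ => ?_
  have := hw.1 m
  split_ifs <;> first | exact le_rfl | assumption | omega

theorem cumWeight_nonneg {M : ℕ} {w : Fin M → ℝ} (hw : w ∈ stdSimplex ℝ (Fin M)) (j : ℕ) :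
    0 ≤ cumWeight w j :=
  Finset.sum_nonneg fun m _ => by split_ifs; exacts [hw.1 m, le_rfl]

theorem cumWeight_le_one {M : ℕ} {w : Fin M → ℝ} (hw : w ∈ stdSimplex ℝ (Fin M)) (j : ℕ) :
    cumWeight w j ≤ 1 := by
  refine (cumWeight_antitone hw (Nat.zero_le j)).trans (le_of_eq ?_)
  rw [← hw.2]
  simp [cumWeight]

theorem sum_smul_sum_range {E : Type*} [AddCommMonoid E] [Module ℝ E] {M : ℕ} (w : Fin M → ℝ)
    (H : ℕ → E) :
    ∑ m : Fin M, w m • ∑ j ∈ Finset.range (m + 1), H j =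
      ∑ j ∈ Finset.range M, cumWeight w j • H j := by
  simp only [cumWeight, Finset.sum_smul, Finset.smul_sum]
  rw [Finset.sum_comm' (t' := Finset.range M)
    (s' := fun j => Finset.univ.filter fun m : Fin M => j ≤ (m : ℕ))]
  · refine Finset.sum_congr rfl fun j _ => ?_
    rw [Finset.sum_filter]
    exact Finset.sum_congr rfl fun m _ => by split_ifs <;> simp
  · intro m j
    have := m.2
    simp only [Finset.mem_univ, Finset.mem_range, Finset.mem_filter, true_and]
    omega

/-! ### Loss and criterion in block coordinates -/

section Loss

variable {n p M : ℕ} {X : Matrix (Fin n) (Fin p) ℝ} {k : ℕ → ℕ}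

theorem IsNestedSizes.le_of_le (hk : IsNestedSizes p M k) {j : ℕ} (hj : j ≤ M) : k j ≤ p :=
  (hk.strictMonoOn.monotoneOn ⟨by omega, hj⟩ ⟨by omega, le_rfl⟩ hj).trans hk.le

theorem IsNestedSizes.initialModel_eq (hk : IsNestedSizes p M k) (r : ℕ) :
    initialModel p (k r) = regressors p (k 0) (k r) := by
  ext l
  simp [initialModel, regressors, hk.zero]

theorem maEstimator_nestedModels (hX : X.rank = p) (hk : IsNestedSizes p M k)
    (w : Fin M → ℝ) (y : Fin n → ℝ) :
    maEstimator X (nestedModels p M k) w y = ∑ j ∈ Finset.range M, cumWeight w j •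
      ∑ l ∈ regressors p (k j) (k (j + 1)), (phi X l ⬝ᵥ y) • phi X l := by
  rw [← sum_smul_sum_range, maEstimator]
  refine Finset.sum_congr rfl fun m _ => ?_
  have hm : (m : ℕ) + 1 ≤ M := m.2
  rw [nestedModels, hatMatrix_initialModel_mulVec hX y _ (hk.le_of_le hm), hk.initialModel_eq,
    ← sum_sum_regressors hk.strictMonoOn _ (Nat.zero_le _) hm, Finset.range_eq_Ico]

theorem sum_card_mul_nestedModels (hk : IsNestedSizes p M k) (w : Fin M → ℝ) :
    ∑ m, ((nestedModels p M k m).card : ℝ) * w m =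
      ∑ j ∈ Finset.range M, cumWeight w j * ((regressors p (k j) (k (j + 1))).card : ℝ) := by
  have h := sum_smul_sum_range w fun j => ((regressors p (k j) (k (j + 1))).card : ℝ)
  simp only [smul_eq_mul] at h
  rw [← h]
  refine Finset.sum_congr rfl fun m _ => ?_
  have hm : (m : ℕ) + 1 ≤ M := m.2
  rw [mul_comm, nestedModels, hk.initialModel_eq]
  congr 1
  have h2 := sum_sum_regressors hk.strictMonoOn (fun _ : Fin p => (1 : ℝ)) (Nat.zero_le _) hm
  simp only [Finset.sum_const, nsmul_eq_mul, mul_one] at h2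
  rw [Finset.range_eq_Ico]
  exact h2.symm

theorem dotProduct_maEstimator (hX : X.rank = p) (hk : IsNestedSizes p M k)
    (w : Fin M → ℝ) (y u : Fin n → ℝ) :
    u ⬝ᵥ maEstimator X (nestedModels p M k) w y = ∑ j ∈ Finset.range M, cumWeight w j *
      ∑ l ∈ regressors p (k j) (k (j + 1)), (phi X l ⬝ᵥ y) * (phi X l ⬝ᵥ u) := by
  rw [maEstimator_nestedModels hX hk, dotProduct_sum]
  refine Finset.sum_congr rfl fun j _ => ?_
  rw [dotProduct_smul, dotProduct_sum, smul_eq_mul]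
  congr 1
  exact Finset.sum_congr rfl fun l _ => by rw [dotProduct_smul, smul_eq_mul, dotProduct_comm u]

theorem phi_dotProduct_maEstimator (hX : X.rank = p) (hk : IsNestedSizes p M k)
    (w : Fin M → ℝ) (y : Fin n → ℝ) {j : ℕ} (hj : j < M) {l : Fin p}
    (hl : l ∈ regressors p (k j) (k (j + 1))) :
    phi X l ⬝ᵥ maEstimator X (nestedModels p M k) w y = cumWeight w j * (phi X l ⬝ᵥ y) := by
  rw [dotProduct_maEstimator hX hk, Finset.sum_eq_single j]
  · rw [Finset.sum_eq_single l]
    · rw [phi_dotProduct_phi X hX, mul_one]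
    · intro i _ hi
      rw [phi_dotProduct_phi_eq_ite hX, if_neg hi, mul_zero]
    · exact fun h => absurd hl h
  · intro i hi hij
    rw [Finset.sum_eq_zero, mul_zero]
    intro i' hi'
    rw [phi_dotProduct_phi_eq_ite hX, if_neg, mul_zero]
    rintro rfl
    simp only [regressors, Finset.mem_filter, Finset.mem_univ, true_and] at hl hi'
    rw [Finset.mem_range] at hi
    rcases lt_or_gt_of_ne hij with h | h
    · have := hk.strictMonoOn.monotoneOn (a := i + 1) (b := j) ⟨by omega, by omega⟩
        ⟨by omega, by omega⟩ h
      omega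
    · have := hk.strictMonoOn.monotoneOn (a := j + 1) (b := i) ⟨by omega, by omega⟩
        ⟨by omega, by omega⟩ h
      omega
  · exact fun h => absurd (Finset.mem_range.2 hj) h

theorem sqNorm_maEstimator (hX : X.rank = p) (hk : IsNestedSizes p M k)
    (w : Fin M → ℝ) (y : Fin n → ℝ) :
    sqNorm (maEstimator X (nestedModels p M k) w y) = ∑ j ∈ Finset.range M, cumWeight w j ^ 2 *
      ∑ l ∈ regressors p (k j) (k (j + 1)), (phi X l ⬝ᵥ y) ^ 2 := by
  rw [sqNorm_eq_dotProduct, dotProduct_maEstimator hX hk]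
  refine Finset.sum_congr rfl fun j hj => ?_
  rw [sq, mul_assoc]
  congr 1
  rw [Finset.mul_sum]
  refine Finset.sum_congr rfl fun l hl => ?_
  rw [phi_dotProduct_maEstimator hX hk w y (Finset.mem_range.1 hj) hl]
  ring

/-- The part of the squared norm of `f` that the largest candidate model does not explain. -/
noncomputable def bias (X : Matrix (Fin n) (Fin p) ℝ) (M : ℕ) (k : ℕ → ℕ) (f : Fin n → ℝ) : ℝ :=
  sqNorm f - ∑ j ∈ Finset.range M, ∑ l ∈ regressors p (k j) (k (j + 1)), (phi X l ⬝ᵥ f) ^ 2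

theorem bias_nonneg (hX : X.rank = p) (hk : IsNestedSizes p M k) (f : Fin n → ℝ) :
    0 ≤ bias X M k f := by
  rw [bias, Finset.range_eq_Ico, sum_sum_regressors hk.strictMonoOn _ (Nat.zero_le _) le_rfl]
  exact sub_nonneg.2 (sum_sq_phi_dotProduct_le hX _ f)

theorem sqNorm_maEstimator_sub (hX : X.rank = p) (hk : IsNestedSizes p M k)
    (w : Fin M → ℝ) (f ε : Fin n → ℝ) :
    sqNorm (maEstimator X (nestedModels p M k) w (f + ε) - f) =
      bias X M k f + ∑ j ∈ Finset.range M,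
        ((1 - cumWeight w j) ^ 2 * ∑ l ∈ regressors p (k j) (k (j + 1)), (phi X l ⬝ᵥ f) ^ 2
        + cumWeight w j ^ 2 * ∑ l ∈ regressors p (k j) (k (j + 1)), (phi X l ⬝ᵥ ε) ^ 2
        - 2 * (cumWeight w j * (1 - cumWeight w j)) *
          ∑ l ∈ regressors p (k j) (k (j + 1)), (phi X l ⬝ᵥ ε) * (phi X l ⬝ᵥ f)) := by
  rw [sqNorm_sub, sqNorm_maEstimator hX hk, dotProduct_comm, dotProduct_maEstimator hX hk, bias,
    Finset.mul_sum, ← Finset.sum_sub_distrib, sub_add_eq_add_sub, add_sub_assoc,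
    ← Finset.sum_sub_distrib, add_comm]
  congr 1
  refine Finset.sum_congr rfl fun j _ => ?_
  simp only [dotProduct_add, Finset.mul_sum, ← Finset.sum_sub_distrib, ← Finset.sum_add_distrib]
  exact Finset.sum_congr rfl fun l _ => by ring

/-- The middle bracket does not involve w and is irrelevant to the minimization. The noise-signal
term γ_j Ξ_j is split as Ξ_j - (1 - γ_j) Ξ_j because the risk controls ∑ (1 - γ_j)² T_j but not ∑
γ_j² T_j. -/
theorem mmaCriterion_eq (hn : 1 ≤ n) (hX : X.rank = p) (hk : IsNestedSizes p M k)
    (w : Fin M → ℝ) (f ε : Fin n → ℝ) (s2 σ : ℝ) :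
    (n : ℝ) * mmaCriterion X (nestedModels p M k) s2 (f + ε) w =
      n * maLoss X (nestedModels p M k) f w (f + ε)
      + (sqNorm ε + 2 * (ε ⬝ᵥ f) - 2 * ∑ j ∈ Finset.range M,
        ∑ l ∈ regressors p (k j) (k (j + 1)), (phi X l ⬝ᵥ ε) * (phi X l ⬝ᵥ f))
      + (2 * ∑ j ∈ Finset.range M, (1 - cumWeight w j) *
          ∑ l ∈ regressors p (k j) (k (j + 1)), (phi X l ⬝ᵥ ε) * (phi X l ⬝ᵥ f)
        - 2 * ∑ j ∈ Finset.range M, cumWeight w j *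
          ∑ l ∈ regressors p (k j) (k (j + 1)), ((phi X l ⬝ᵥ ε) ^ 2 - σ ^ 2)
        + 2 * ((s2 - σ ^ 2) * ∑ j ∈ Finset.range M,
          cumWeight w j * ((regressors p (k j) (k (j + 1))).card : ℝ))) := by
  have hn0 : (n : ℝ) ≠ 0 := by positivity
  have h1 : f + ε - maEstimator X (nestedModels p M k) w (f + ε) =
      ε - (maEstimator X (nestedModels p M k) w (f + ε) - f) := by abel
  rw [mmaCriterion, maLoss, mul_add, mul_inv_cancel_left₀ hn0, mul_inv_cancel_left₀ hn0, h1,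
    sqNorm_sub, dotProduct_sub, dotProduct_maEstimator hX hk, sum_card_mul_nestedModels hk]
  have h2 : (n : ℝ) * (2 * s2 / n * ∑ j ∈ Finset.range M,
      cumWeight w j * ((regressors p (k j) (k (j + 1))).card : ℝ)) = 2 * s2 *
      ∑ j ∈ Finset.range M, cumWeight w j * ((regressors p (k j) (k (j + 1))).card : ℝ) := by
    field_simp
  rw [h2]
  have h3 : ∑ j ∈ Finset.range M, cumWeight w j * ∑ l ∈ regressors p (k j) (k (j + 1)),
        (phi X l ⬝ᵥ (f + ε)) * (phi X l ⬝ᵥ ε) =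
      ∑ j ∈ Finset.range M, ∑ l ∈ regressors p (k j) (k (j + 1)),
        (phi X l ⬝ᵥ ε) * (phi X l ⬝ᵥ f)
      - ∑ j ∈ Finset.range M, (1 - cumWeight w j) *
          ∑ l ∈ regressors p (k j) (k (j + 1)), (phi X l ⬝ᵥ ε) * (phi X l ⬝ᵥ f)
      + ∑ j ∈ Finset.range M, cumWeight w j *
          ∑ l ∈ regressors p (k j) (k (j + 1)), ((phi X l ⬝ᵥ ε) ^ 2 - σ ^ 2)
      + σ ^ 2 * ∑ j ∈ Finset.range M,
          cumWeight w j * ((regressors p (k j) (k (j + 1))).card : ℝ) := by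
    rw [Finset.mul_sum, ← Finset.sum_sub_distrib, ← Finset.sum_add_distrib,
      ← Finset.sum_add_distrib]
    refine Finset.sum_congr rfl fun j _ => ?_
    simp only [dotProduct_add, add_mul, Finset.sum_add_distrib, Finset.sum_sub_distrib,
      Finset.sum_const, nsmul_eq_mul, ← sq, mul_comm (phi X _ ⬝ᵥ f)]
    ring
  rw [h3]
  ring

end Loss

/-! ### Moments of block sums, and the risk -/

section Moments

variable {Ω : Type*} [MeasurableSpace Ω] {P : Measure Ω}
  {n p M : ℕ} {X : Matrix (Fin n) (Fin p) ℝ} {k : ℕ → ℕ} {ε : Fin n → Ω → ℝ} {σ κ : ℝ}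

theorem memLp_dotProduct (hL : ∀ i, MemLp (ε i) 4 P) (c : Fin n → ℝ) :
    MemLp (fun ω => c ⬝ᵥ fun i => ε i ω) 4 P :=
  memLp_finsetSum _ fun i _ => (hL i).const_mul (c i)

theorem integral_dotProduct [IsProbabilityMeasure P] (hL : ∀ i, MemLp (ε i) 4 P)
    (hmean : ∀ i, ∫ ω, ε i ω ∂P = 0) (c : Fin n → ℝ) :
    ∫ ω, (c ⬝ᵥ fun i => ε i ω) ∂P = 0 := by
  simp only [dotProduct]
  rw [integral_finsetSum _ fun i _ => ((hL i).integrable (by norm_num)).const_mul _]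
  exact Finset.sum_eq_zero fun i _ => by rw [integral_const_mul, hmean, mul_zero]

theorem integral_sq_dotProduct [IsProbabilityMeasure P] (hind : iIndepFun ε P)
    (hL : ∀ i, MemLp (ε i) 4 P) (hmean : ∀ i, ∫ ω, ε i ω ∂P = 0)
    (hvar : ∀ i, ∫ ω, ε i ω ^ 2 ∂P = σ ^ 2) (c : Fin n → ℝ) :
    ∫ ω, (c ⬝ᵥ fun i => ε i ω) ^ 2 ∂P = σ ^ 2 * (c ⬝ᵥ c) := by
  rw [← sqNorm_eq_dotProduct]
  exact integral_sq_linearForm hind hL hmean hvar Finset.univ c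

theorem integral_sq_sum_phi_mul [IsProbabilityMeasure P] (hX : X.rank = p) (hind : iIndepFun ε P)
    (hL : ∀ i, MemLp (ε i) 4 P) (hmean : ∀ i, ∫ ω, ε i ω ∂P = 0)
    (hvar : ∀ i, ∫ ω, ε i ω ^ 2 ∂P = σ ^ 2) (s : Finset (Fin p)) (t : Fin p → ℝ) :
    ∫ ω, (∑ l ∈ s, (phi X l ⬝ᵥ fun i => ε i ω) * t l) ^ 2 ∂P = σ ^ 2 * ∑ l ∈ s, t l ^ 2 := by
  rw [← sum_smul_phi_dotProduct_sum_smul_phi hX,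
    ← integral_sq_dotProduct hind hL hmean hvar]
  congr 1
  funext ω
  rw [sum_dotProduct]
  congr 1
  exact Finset.sum_congr rfl fun l _ => by rw [smul_dotProduct, smul_eq_mul, mul_comm]

/-- The sum is the centred quadratic form of the projection ∑ φ_l φ_lᵀ, whose squared Frobenius norm
is its rank. -/
theorem integral_sq_sum_phi_sq_sub_le [IsProbabilityMeasure P] (hX : X.rank = p)
    (hind : iIndepFun ε P) (hL : ∀ i, MemLp (ε i) 4 P) (hmean : ∀ i, ∫ ω, ε i ω ∂P = 0)
    (hvar : ∀ i, ∫ ω, ε i ω ^ 2 ∂P = σ ^ 2)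
    (hκ : ∀ i, ∫ ω, (ε i ω ^ 2 - σ ^ 2) ^ 2 ∂P ≤ κ) (s : Finset (Fin p)) :
    ∫ ω, (∑ l ∈ s, ((phi X l ⬝ᵥ fun i => ε i ω) ^ 2 - σ ^ 2)) ^ 2 ∂P ≤
      (2 * κ + 4 * σ ^ 4) * s.card := by
  have h := integral_sq_quadraticForm_le hind hL hmean hvar hκ
    (fun i j => ∑ l ∈ s, phi X l i * phi X l j)
    (fun i j => Finset.sum_congr rfl fun l _ => mul_comm _ _) Finset.univ
  have h1 : ∑ i, ∑ j, (∑ l ∈ s, phi X l i * phi X l j) ^ 2 = s.card := by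
    have h2 : ∀ i j, (∑ l ∈ s, phi X l i * phi X l j) ^ 2 =
        ∑ l ∈ s, ∑ l' ∈ s, (phi X l i * phi X l' i) * (phi X l j * phi X l' j) := by
      intro i j
      rw [sq, Finset.sum_mul_sum]
      exact Finset.sum_congr rfl fun l _ => Finset.sum_congr rfl fun l' _ => by ring
    have h3 : ∀ l l', ∑ i, ∑ j, (phi X l i * phi X l' i) * (phi X l j * phi X l' j) =
        if l = l' then 1 else 0 := by
      intro l l'
      rw [← Finset.sum_mul_sum]
      have := phi_dotProduct_phi_eq_ite hX l l'
      rw [dotProduct] at this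
      rw [this]
      split_ifs <;> simp
    have h4 : ∑ i, ∑ j, ∑ l ∈ s, ∑ l' ∈ s, (phi X l i * phi X l' i) * (phi X l j * phi X l' j) =
        ∑ l ∈ s, ∑ l' ∈ s, ∑ i, ∑ j, (phi X l i * phi X l' i) * (phi X l j * phi X l' j) := by
      rw [Finset.sum_congr rfl fun i _ => Finset.sum_comm, Finset.sum_comm]
      refine Finset.sum_congr rfl fun l _ => ?_
      rw [Finset.sum_congr rfl fun i _ => Finset.sum_comm, Finset.sum_comm]
    simp only [h2]
    rw [h4]
    simp only [h3]
    rw [Finset.sum_congr rfl fun l hl => by rw [Finset.sum_ite_eq, if_pos hl]]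
    simp
  rw [h1] at h
  refine le_trans (le_of_eq ?_) h
  congr 1
  funext ω
  congr 1
  have h5 : ∀ l, ((phi X l ⬝ᵥ fun i => ε i ω) ^ 2 - σ ^ 2) = ∑ i, ∑ j,
      phi X l i * phi X l j * (ε i ω * ε j ω - if i = j then σ ^ 2 else 0) := by
    intro l
    have h6 : σ ^ 2 = ∑ i, ∑ j, phi X l i * phi X l j * (if i = j then σ ^ 2 else 0) := by
      have := phi_dotProduct_phi X hX l
      rw [dotProduct] at this
      simp only [mul_ite, mul_zero, Finset.sum_ite_eq, Finset.mem_univ, if_true]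
      rw [← Finset.sum_mul, this, one_mul]
    simp only [mul_sub, Finset.sum_sub_distrib]
    rw [← h6, sq, dotProduct, Finset.sum_mul_sum]
    congr 1
    exact Finset.sum_congr rfl fun l _ => Finset.sum_congr rfl fun l' _ => by ring
  simp only [h5, Finset.sum_mul]
  rw [Finset.sum_comm]
  refine Finset.sum_congr rfl fun i _ => ?_
  rw [Finset.sum_comm]

theorem mul_maRisk [IsProbabilityMeasure P] (hn : 1 ≤ n) (hX : X.rank = p)
    (hk : IsNestedSizes p M k) (hind : iIndepFun ε P)
    (hL : ∀ i, MemLp (ε i) 4 P) (hmean : ∀ i, ∫ ω, ε i ω ∂P = 0)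
    (hvar : ∀ i, ∫ ω, ε i ω ^ 2 ∂P = σ ^ 2) (f : Fin n → ℝ) (w : Fin M → ℝ) :
    (n : ℝ) * maRisk P X (nestedModels p M k) f ε w = bias X M k f + ∑ j ∈ Finset.range M,
      ((1 - cumWeight w j) ^ 2 * ∑ l ∈ regressors p (k j) (k (j + 1)), (phi X l ⬝ᵥ f) ^ 2
      + cumWeight w j ^ 2 * (σ ^ 2 * (regressors p (k j) (k (j + 1))).card)) := by
  have hn0 : (n : ℝ) ≠ 0 := by positivity
  have hE : ∀ l, MemLp (fun ω => phi X l ⬝ᵥ fun i => ε i ω) 4 P := fun l =>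
    memLp_dotProduct hL _
  have hE1 : ∀ l, Integrable (fun ω => phi X l ⬝ᵥ fun i => ε i ω) P := fun l =>
    (hE l).integrable (by norm_num)
  have hE2 : ∀ l, Integrable (fun ω => (phi X l ⬝ᵥ fun i => ε i ω) ^ 2) P := fun l =>
    ((hE l).mono_exponent (by norm_num : (2 : ENNReal) ≤ 4)).integrable_sq
  rw [maRisk]
  simp only [maLoss]
  rw [integral_const_mul, mul_inv_cancel_left₀ hn0]
  have h1 : ∀ ω, sqNorm (maEstimator X (nestedModels p M k) w (fun i => f i + ε i ω) - f) = _ :=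
    fun ω => sqNorm_maEstimator_sub hX hk w f fun i => ε i ω
  simp only [h1]
  have hi1 : ∀ j, Integrable (fun ω =>
      ∑ l ∈ regressors p (k j) (k (j + 1)), (phi X l ⬝ᵥ fun i => ε i ω) ^ 2) P := fun j =>
    integrable_finsetSum _ fun l _ => hE2 l
  have hi2 : ∀ j, Integrable (fun ω => ∑ l ∈ regressors p (k j) (k (j + 1)),
      (phi X l ⬝ᵥ fun i => ε i ω) * (phi X l ⬝ᵥ f)) P := fun j =>
    integrable_finsetSum _ fun l _ => (hE1 l).mul_const _
  have hv1 : ∀ j, ∫ ω, ∑ l ∈ regressors p (k j) (k (j + 1)), (phi X l ⬝ᵥ fun i => ε i ω) ^ 2 ∂P =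
      σ ^ 2 * (regressors p (k j) (k (j + 1))).card := by
    intro j
    rw [integral_finsetSum _ fun l _ => hE2 l]
    simp only [integral_sq_dotProduct hind hL hmean hvar, phi_dotProduct_phi X hX]
    simp [mul_comm]
  have hv2 : ∀ j, ∫ ω, ∑ l ∈ regressors p (k j) (k (j + 1)),
      (phi X l ⬝ᵥ fun i => ε i ω) * (phi X l ⬝ᵥ f) ∂P = 0 := by
    intro j
    rw [integral_finsetSum _ fun l _ => (hE1 l).mul_const _]
    exact Finset.sum_eq_zero fun l _ => by
      rw [integral_mul_const, integral_dotProduct hL hmean, zero_mul]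
  have hi3 := fun j => ((integrable_const (μ := P) ((1 - cumWeight w j) ^ 2 *
    ∑ l ∈ regressors p (k j) (k (j + 1)), (phi X l ⬝ᵥ f) ^ 2)).add
    ((hi1 j).const_mul (cumWeight w j ^ 2)))
  have hi4 := fun j => (hi3 j).sub ((hi2 j).const_mul (2 * (cumWeight w j * (1 - cumWeight w j))))
  refine (integral_add (integrable_const _) (integrable_finsetSum _ fun j _ => hi4 j)).trans ?_
  congr 1
  · simp
  refine (integral_finsetSum _ fun j _ => hi4 j).trans ?_
  refine Finset.sum_congr rfl fun j _ => ?_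
  refine (integral_sub (hi3 j) ((hi2 j).const_mul _)).trans ?_
  rw [integral_const_mul, hv2, mul_zero, sub_zero]
  refine (integral_add (integrable_const _) ((hi1 j).const_mul _)).trans ?_
  rw [integral_const, integral_const_mul, hv1]
  simp

end Moments

/-! ### Bounds by the complexity ψ -/

section Complexity

variable {p M : ℕ} {k : ℕ → ℕ}

theorem tailSum_eq (hk : IsNestedSizes p M k) (θ : Fin p → ℝ) {j : ℕ} (hj : j ≤ M) :
    tailSum θ M k j =
      ∑ i ∈ Finset.Ico j M, ∑ l ∈ regressors p (k i) (k (i + 1)), θ l ^ 2 := by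
  rw [sum_sum_regressors hk.strictMonoOn _ hj le_rfl, tailSum]
  congr 1
  ext l
  simp only [regressors, Finset.mem_filter, Finset.mem_univ, true_and]
  omega

theorem tailSum_nonneg (θ : Fin p → ℝ) (j : ℕ) : 0 ≤ tailSum θ M k j :=
  Finset.sum_nonneg fun _ _ => sq_nonneg _

theorem tailSum_antitone (hk : IsNestedSizes p M k) (θ : Fin p → ℝ) {i j : ℕ} (hij : i ≤ j)
    (hj : j ≤ M) : tailSum θ M k j ≤ tailSum θ M k i := by
  rw [tailSum_eq hk θ hj, tailSum_eq hk θ (hij.trans hj)]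
  exact Finset.sum_le_sum_of_subset_of_nonneg (Finset.Ico_subset_Ico_left hij)
    fun _ _ _ => Finset.sum_nonneg fun _ _ => sq_nonneg _

theorem firstZero_mem (hk : IsNestedSizes p M k) (θ : Fin p → ℝ) :
    1 ≤ firstZero θ M k ∧ firstZero θ M k ≤ M ∧ tailSum θ M k (firstZero θ M k) = 0 := by
  refine Nat.sInf_mem (s := {j | 1 ≤ j ∧ j ≤ M ∧ tailSum θ M k j = 0}) ⟨M, hk.one_le, le_rfl, ?_⟩
  rw [tailSum_eq hk θ le_rfl]
  simp

theorem tailSum_ratio_nonneg (hk : IsNestedSizes p M k) (θ : Fin p → ℝ) {j : ℕ} (hj : j ≤ M) :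
    0 ≤ (tailSum θ M k (j - 1) - tailSum θ M k j) / (4 * tailSum θ M k j) :=
  div_nonneg (sub_nonneg.2 (tailSum_antitone hk θ (Nat.sub_le j 1) hj))
    (mul_nonneg (by norm_num) (tailSum_nonneg θ j))

theorem size_ratio_nonneg (hk : IsNestedSizes p M k) {j : ℕ} (hj : j < M) :
    0 ≤ ((k (j + 1) : ℝ) - k j) / (4 * k j) := by
  have h : k j ≤ k (j + 1) :=
    hk.strictMonoOn.monotoneOn ⟨by omega, by omega⟩ ⟨by omega, by omega⟩ (Nat.le_succ j)
  have h' : (k j : ℝ) ≤ k (j + 1) := by exact_mod_cast h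
  exact div_nonneg (sub_nonneg.2 h') (by positivity)

theorem min_signal_le_psi (hk : IsNestedSizes p M k) (θ : Fin p → ℝ) :
    min (M : ℝ) (1 + ∑ j ∈ Finset.Ico 1 M,
      (∑ l ∈ regressors p (k (j - 1)) (k (j - 1 + 1)), θ l ^ 2) /
        (4 * ∑ i ∈ Finset.Ico j M, ∑ l ∈ regressors p (k i) (k (i + 1)), θ l ^ 2))
      * (1 + Real.log M) ^ 2 ≤ psi θ M k := by
  rw [psi]
  refine mul_le_mul_of_nonneg_right (min_le_min_left _ ?_) (sq_nonneg _)
  have h1 : ∑ j ∈ Finset.Ico 1 M, (∑ l ∈ regressors p (k (j - 1)) (k (j - 1 + 1)), θ l ^ 2) /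
        (4 * ∑ i ∈ Finset.Ico j M, ∑ l ∈ regressors p (k i) (k (i + 1)), θ l ^ 2) =
      ∑ j ∈ Finset.Ico 1 M,
        (tailSum θ M k (j - 1) - tailSum θ M k j) / (4 * tailSum θ M k j) := by
    refine Finset.sum_congr rfl fun j hj => ?_
    rw [Finset.mem_Ico] at hj
    obtain ⟨i, rfl⟩ : ∃ i, j = i + 1 := ⟨j - 1, by omega⟩
    rw [← tailSum_eq hk θ hj.2.le, Nat.add_sub_cancel, tailSum_eq hk θ (j := i) (by omega),
      Finset.sum_eq_sum_Ico_succ_bot (by omega : i < M), ← tailSum_eq hk θ hj.2.le,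
      add_sub_cancel_right]
  -- From `firstZero` on the tail vanishes, and division by zero yields 0, so the truncated and the
  -- full sums agree.
  have h2 : ∑ j ∈ Finset.Ico 1 (firstZero θ M k),
        (tailSum θ M k (j - 1) - tailSum θ M k j) / (4 * tailSum θ M k j) =
      ∑ j ∈ Finset.Ico 1 M,
        (tailSum θ M k (j - 1) - tailSum θ M k j) / (4 * tailSum θ M k j) := by
    obtain ⟨_, hM, hz⟩ := firstZero_mem hk θ
    refine Finset.sum_subset (Finset.Ico_subset_Ico_right hM) fun j hj hj' => ?_
    simp only [Finset.mem_Ico] at hj hj'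
    have h3 : tailSum θ M k j = 0 :=
      le_antisymm (hz ▸ tailSum_antitone hk θ (by omega) hj.2.le) (tailSum_nonneg θ j)
    rw [h3]
    simp
  have h3 : 0 ≤ ∑ j ∈ Finset.Ico 1 M, ((k (j + 1) : ℝ) - k j) / (4 * k j) :=
    Finset.sum_nonneg fun j hj => size_ratio_nonneg hk (Finset.mem_Ico.1 hj).2
  rw [h1, h2]
  linarith

theorem min_size_le_psi (hk : IsNestedSizes p M k) (θ : Fin p → ℝ) :
    min (M : ℝ) (1 + ∑ j ∈ Finset.Ico 1 M, ((k (j + 1) : ℝ) - k j) / (4 * k j))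
      * (1 + Real.log M) ^ 2 ≤ psi θ M k := by
  rw [psi]
  refine mul_le_mul_of_nonneg_right (min_le_min_left _ ?_) (sq_nonneg _)
  have h := Finset.sum_nonneg fun j (hj : j ∈ Finset.Ico 1 (firstZero θ M k)) =>
    tailSum_ratio_nonneg hk θ ((Finset.mem_Ico.1 hj).2.le.trans (firstZero_mem hk θ).2.1)
  linarith

theorem one_le_psi (hk : IsNestedSizes p M k) (θ : Fin p → ℝ) : 1 ≤ psi θ M k := by
  refine le_trans ?_ (min_size_le_psi hk θ)
  have h3 : 0 ≤ ∑ j ∈ Finset.Ico 1 M, ((k (j + 1) : ℝ) - k j) / (4 * k j) :=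
    Finset.sum_nonneg fun j hj => size_ratio_nonneg hk (Finset.mem_Ico.1 hj).2
  have h1 : (1 : ℝ) ≤ M := by exact_mod_cast hk.one_le
  have h4 : (1 : ℝ) ≤ (1 + Real.log M) ^ 2 := one_le_pow₀ (by linarith [Real.log_nonneg h1])
  exact one_le_mul_of_one_le_of_one_le (le_min h1 (by linarith)) h4

end Complexity

/-! ### Majorants for the signal and noise terms -/

section Majorants

variable {Ω : Type*} [MeasurableSpace Ω] {P : Measure Ω} [IsProbabilityMeasure P]
  {n p M : ℕ} {X : Matrix (Fin n) (Fin p) ℝ} {k : ℕ → ℕ} {ε : Fin n → Ω → ℝ} {σ κ : ℝ}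

theorem exists_signal_majorant (hn : 1 ≤ n) (hX : X.rank = p)
    (hk : IsNestedSizes p M k) (hind : iIndepFun ε P)
    (hL : ∀ i, MemLp (ε i) 4 P) (hmean : ∀ i, ∫ ω, ε i ω ∂P = 0)
    (hvar : ∀ i, ∫ ω, ε i ω ^ 2 ∂P = σ ^ 2) (f : Fin n → ℝ) :
    ∃ Z : Ω → ℝ, Integrable Z P ∧ (∀ ω, 0 ≤ Z ω) ∧
      ∫ ω, Z ω ∂P ≤ 512 * σ ^ 2 * psi (theta X f) M k ∧
      ∀ ω (α : ℕ → ℝ), Monotone α → (∀ i, 0 ≤ α i) →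
        (∑ j ∈ Finset.range M, α j * ∑ l ∈ regressors p (k j) (k (j + 1)),
            (phi X l ⬝ᵥ fun i => ε i ω) * (phi X l ⬝ᵥ f)) ^ 2 ≤
          (∑ j ∈ Finset.range M, α j ^ 2 *
            ∑ l ∈ regressors p (k j) (k (j + 1)), (phi X l ⬝ᵥ f) ^ 2) * Z ω := by
  have hn0 : (0 : ℝ) < n := by positivity
  have hθ : ∀ l, (phi X l ⬝ᵥ f) ^ 2 = n * theta X f l ^ 2 := by
    intro l
    rw [theta, div_pow, Real.sq_sqrt hn0.le, mul_div_cancel₀ _ hn0.ne']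
  obtain ⟨Z, hZi, hZ0, hZe, hZm⟩ := exists_monotone_majorant (P := P) (M := M)
    (x := fun j ω => ∑ l ∈ regressors p (k j) (k (j + 1)),
      (phi X l ⬝ᵥ fun i => ε i ω) * (phi X l ⬝ᵥ f))
    (v := fun j => ∑ l ∈ regressors p (k j) (k (j + 1)), theta X f l ^ 2)
    (B := σ ^ 2 * n) hk.one_le (by positivity)
    (fun j => Finset.sum_nonneg fun l _ => sq_nonneg _)
    (fun j => memLp_finsetSum _ fun l _ =>
      ((memLp_dotProduct hL _).mono_exponent (by norm_num)).mul_const _)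
    (fun j _ hj ω => Finset.sum_eq_zero fun l hl => by
      have h0 := (Finset.sum_eq_zero_iff_of_nonneg fun l _ => sq_nonneg _).1 hj l hl
      have h1 := hθ l
      rw [h0, mul_zero, sq_eq_zero_iff] at h1
      rw [h1, mul_zero])
    (fun a b hab hb => by
      simp only [sum_sum_regressors hk.strictMonoOn _ hab hb]
      rw [integral_sq_sum_phi_mul hX hind hL hmean hvar]
      simp only [hθ]
      rw [← Finset.mul_sum, mul_assoc])
  refine ⟨fun ω => (n : ℝ)⁻¹ * Z ω, hZi.const_mul _, fun ω => ?_, ?_, ?_⟩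
  · have := hZ0 ω
    positivity
  · rw [integral_const_mul, inv_mul_le_iff₀ hn0]
    refine hZe.trans ?_
    have := mul_le_mul_of_nonneg_left (min_signal_le_psi hk (theta X f))
      (by positivity : 0 ≤ 512 * (σ ^ 2 * n))
    linarith
  · intro ω α hα hα0
    refine (hZm ω α hα hα0).trans (le_of_eq ?_)
    simp only [hθ]
    simp only [← Finset.mul_sum, mul_left_comm _ (n : ℝ)]
    field_simp

/-- The coefficients γ decrease, so the blocks are taken in reverse order. The tail masses then
become the initial sizes k_i, and the ratios of v to its tails become those of successive model
sizes in `psi`. -/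
theorem exists_noise_majorant (hX : X.rank = p)
    (hk : IsNestedSizes p M k) (hind : iIndepFun ε P)
    (hL : ∀ i, MemLp (ε i) 4 P) (hmean : ∀ i, ∫ ω, ε i ω ∂P = 0)
    (hvar : ∀ i, ∫ ω, ε i ω ^ 2 ∂P = σ ^ 2) (hκ0 : 0 ≤ κ)
    (hκ : ∀ i, ∫ ω, (ε i ω ^ 2 - σ ^ 2) ^ 2 ∂P ≤ κ) (θ : Fin p → ℝ) :
    ∃ Z : Ω → ℝ, Integrable Z P ∧ (∀ ω, 0 ≤ Z ω) ∧
      ∫ ω, Z ω ∂P ≤ 512 * (2 * κ + 4 * σ ^ 4) * psi θ M k ∧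
      ∀ ω (γ : ℕ → ℝ), Antitone γ → (∀ i, 0 ≤ γ i) →
        (∑ j ∈ Finset.range M, γ j * ∑ l ∈ regressors p (k j) (k (j + 1)),
            ((phi X l ⬝ᵥ fun i => ε i ω) ^ 2 - σ ^ 2)) ^ 2 ≤
          (∑ j ∈ Finset.range M, γ j ^ 2 * ((regressors p (k j) (k (j + 1))).card : ℝ)) * Z ω := by
  have hM := hk.one_le
  have hcard : ∀ a b, a ≤ b → b ≤ M →
      ∑ j ∈ Finset.Ico a b, ((regressors p (k j) (k (j + 1))).card : ℝ) =
        ((regressors p (k a) (k b)).card : ℝ) := by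
    intro a b hab hb
    have := sum_sum_regressors hk.strictMonoOn (fun _ : Fin p => (1 : ℝ)) hab hb
    simpa only [Finset.sum_const, nsmul_eq_mul, mul_one] using this
  have hd : ∀ j, j < M → ((regressors p (k j) (k (j + 1))).card : ℝ) = k (j + 1) - k j := by
    intro j hj
    rw [card_regressors (hk.le_of_le hj), Nat.cast_sub]
    exact hk.strictMonoOn.monotoneOn ⟨by omega, by omega⟩ ⟨by omega, by omega⟩ (Nat.le_succ j)
  obtain ⟨Z, hZi, hZ0, hZe, hZm⟩ := exists_monotone_majorant (P := P) (M := M)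
    (x := fun j ω => (fun i => ∑ l ∈ regressors p (k i) (k (i + 1)),
      ((phi X l ⬝ᵥ fun i => ε i ω) ^ 2 - σ ^ 2)) (M - 1 - j))
    (v := fun j => (fun i => ((regressors p (k i) (k (i + 1))).card : ℝ)) (M - 1 - j))
    (B := 2 * κ + 4 * σ ^ 4) hM (by positivity)
    (fun j => Nat.cast_nonneg _)
    (fun j => memLp_finsetSum _ fun l _ => by
      have := (memLp_mul_two (memLp_dotProduct hL (phi X l)) (memLp_dotProduct hL (phi X l))).sub
        (memLp_const (σ ^ 2))
      simpa only [← sq, Pi.sub_def] using this)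
    (fun j hj hv ω => by
      have h0 : regressors p (k (M - 1 - j)) (k (M - 1 - j + 1)) = ∅ :=
        Finset.card_eq_zero.1 (Nat.cast_eq_zero.1 hv)
      simp only [h0, Finset.sum_empty])
    (fun a b hab hb => by
      have h1 : ∀ ω, _ = _ := fun ω => (Finset.sum_Ico_reflect
        (fun i => ∑ l ∈ regressors p (k i) (k (i + 1)),
          ((phi X l ⬝ᵥ fun i => ε i ω) ^ 2 - σ ^ 2)) a (by omega : b ≤ M - 1 + 1)).trans
        (sum_sum_regressors hk.strictMonoOn _ (by omega) (by omega))
      have h2 := (Finset.sum_Ico_reflect (fun i => ((regressors p (k i) (k (i + 1))).card : ℝ)) a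
        (by omega : b ≤ M - 1 + 1)).trans (hcard _ _ (by omega) (by omega))
      simp only [h1, h2]
      exact integral_sq_sum_phi_sq_sub_le hX hind hL hmean hvar hκ _)
  refine ⟨Z, hZi, hZ0, ?_, ?_⟩
  · refine hZe.trans ?_
    refine mul_le_mul_of_nonneg_left (le_trans (le_of_eq ?_) (min_size_le_psi hk θ))
      (by positivity)
    congr 3
    have h1 : ∀ j ∈ Finset.Ico 1 M,
        ((regressors p (k (M - 1 - (j - 1))) (k (M - 1 - (j - 1) + 1))).card : ℝ) /
          (4 * ∑ i ∈ Finset.Ico j M,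
            ((regressors p (k (M - 1 - i)) (k (M - 1 - i + 1))).card : ℝ)) =
        (fun i => ((k (i + 1) : ℝ) - k i) / (4 * k i)) (M - j) := by
      intro j hj
      rw [Finset.mem_Ico] at hj
      rw [Finset.sum_Ico_reflect (fun i => ((regressors p (k i) (k (i + 1))).card : ℝ)) j
        (by omega : M ≤ M - 1 + 1), hcard _ _ (by omega) (by omega),
        show M - 1 - (j - 1) = M - j by omega, hd _ (by omega),
        show M - 1 + 1 - M = 0 by omega, show M - 1 + 1 - j = M - j by omega, hk.zero,
        card_regressors (hk.le_of_le (by omega)), Nat.sub_zero]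
    rw [Finset.sum_congr rfl h1, Finset.sum_Ico_reflect
      (fun i => ((k (i + 1) : ℝ) - k i) / (4 * k i)) 1 (by omega : M ≤ M + 1)]
    congr 2
    omega
  · intro ω γ hγ hγ0
    have h := hZm ω (fun j => γ (M - 1 - j)) (fun i j hij => hγ (by omega)) fun i => hγ0 _
    have h1 := Finset.sum_range_reflect (fun j => γ j * ∑ l ∈ regressors p (k j) (k (j + 1)),
            ((phi X l ⬝ᵥ fun i => ε i ω) ^ 2 - σ ^ 2)) M
    have h2 := Finset.sum_range_reflect
      (fun j => γ j ^ 2 * ((regressors p (k j) (k (j + 1))).card : ℝ)) M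
    rw [← h1, ← h2]
    exact h

end Majorants

/-! ### From uniform closeness to near-optimality -/

/-- If a loss and a criterion are both uniformly close to a risk, a minimizer of the criterion
nearly minimizes the loss. -/
theorem abs_div_iInf_sub_one_le {W : Type*} {S : Set W} {L ρ D C : W → ℝ} {c δ r : ℝ} {u : W}
    (hδ0 : 0 ≤ δ) (hδ : δ ≤ 1 / 20) (hr : 0 < r) (hρ : ∀ w ∈ S, r ≤ ρ w)
    (hL : ∀ w ∈ S, |L w - ρ w| ≤ 5 * δ * ρ w) (hD : ∀ w ∈ S, |D w| ≤ 6 * δ * ρ w)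
    (hC : ∀ w ∈ S, C w = L w + c + D w) (hu : u ∈ S) (hmin : IsMinOn C S u) :
    |L u / (⨅ w : S, L w) - 1| ≤ 32 * δ := by
  have hne : Nonempty S := ⟨⟨u, hu⟩⟩
  -- Since 5δ ≤ 1/4, the loss is at least 3/4 of the risk, and 6 / (3/4) = 8.
  have hDL : ∀ w ∈ S, |D w| ≤ 8 * δ * L w := by
    intro w hw
    have h1 := hL w hw
    have h2 := hD w hw
    have h3 := hρ w hw
    rw [abs_le] at h1
    have h4 : ρ w * (3 / 4) ≤ L w := by nlinarith
    nlinarith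
  have hLr : ∀ w ∈ S, r * (3 / 4) ≤ L w := by
    intro w hw
    have h1 := hL w hw
    have h3 := hρ w hw
    rw [abs_le] at h1
    nlinarith
  have hbdd : BddBelow (Set.range fun w : S => L w) :=
    ⟨r * (3 / 4), by rintro _ ⟨w, rfl⟩; exact hLr w w.2⟩
  set I := ⨅ w : S, L w with hI
  have hIu : I ≤ L u := ciInf_le hbdd ⟨u, hu⟩
  have hIr : r * (3 / 4) ≤ I := le_ciInf fun w => hLr w w.2
  have hIpos : 0 < I := by linarith
  have hkey : (1 - 8 * δ) * L u ≤ (1 + 8 * δ) * I := by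
    have h8 : (0 : ℝ) < 1 + 8 * δ := by linarith
    rw [← div_le_iff₀' h8]
    refine le_ciInf fun w => ?_
    rw [div_le_iff₀' h8]
    have h1 := hmin w.2
    change C u ≤ C w at h1
    rw [hC u hu, hC w w.2] at h1
    have h2 := abs_le.1 (hDL u hu)
    have h3 := abs_le.1 (hDL w w.2)
    linarith
  have hge : 1 ≤ L u / I := (one_le_div hIpos).2 hIu
  rw [abs_of_nonneg (by linarith), sub_le_iff_le_add', div_le_iff₀ hIpos]
  -- That (1 + 8δ) / (1 - 8δ) ≤ 1 + 32δ amounts to δ (16 - 256δ) ≥ 0, which holds for δ ≤ 1/16.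
  have : (1 + 8 * δ) * I ≤ (1 - 8 * δ) * ((1 + 32 * δ) * I) := by
    have : 0 ≤ δ * (16 - 256 * δ) * I := by
      refine mul_nonneg (mul_nonneg hδ0 ?_) hIpos.le
      linarith
    nlinarith
  exact le_of_mul_le_mul_left (hkey.trans this) (by linarith)

theorem abs_le_mul_of_sq_le {b ρ Y Y' δ r : ℝ} (hδ : 0 ≤ δ) (hr : 0 ≤ r) (hrρ : r ≤ ρ)
    (hb : b ^ 2 ≤ ρ * Y') (hY' : Y' ≤ Y) (hY : Y ≤ δ ^ 2 * r) : |b| ≤ δ * ρ := by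
  have hρ := hr.trans hrρ
  refine abs_le_of_sq_le_sq (hb.trans ?_) (mul_nonneg hδ hρ)
  have h1 : Y' ≤ δ ^ 2 * ρ :=
    (hY'.trans hY).trans (mul_le_mul_of_nonneg_left hrρ (sq_nonneg δ))
  have h2 := mul_le_mul_of_nonneg_left h1 hρ
  linarith

section Control

variable {Ω : Type*} [MeasurableSpace Ω] {P : Measure Ω}
  {n p M : ℕ} {X : Matrix (Fin n) (Fin p) ℝ} {k : ℕ → ℕ} {ε : Fin n → Ω → ℝ} {σ κ : ℝ}

theorem maRisk_nonneg (I : Fin M → Finset (Fin p)) (f : Fin n → ℝ) (w : Fin M → ℝ) :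
    0 ≤ maRisk P X I f ε w :=
  integral_nonneg fun _ => mul_nonneg (by positivity) (sqNorm_nonneg _)

theorem optRisk_nonneg (I : Fin M → Finset (Fin p)) (f : Fin n → ℝ) :
    0 ≤ optRisk P X I f ε :=
  Real.iInf_nonneg fun _ => maRisk_nonneg _ _ _

theorem optRisk_le (I : Fin M → Finset (Fin p)) (f : Fin n → ℝ) {w : Fin M → ℝ}
    (hw : w ∈ stdSimplex ℝ (Fin M)) : optRisk P X I f ε ≤ maRisk P X I f ε w :=
  ciInf_le (f := fun w : stdSimplex ℝ (Fin M) => maRisk P X I f ε w)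
    ⟨0, by rintro _ ⟨w, rfl⟩; exact maRisk_nonneg _ _ _⟩ ⟨w, hw⟩

/-- Lets the majorants be applied to the squared coefficients (1 - γ)² and γ², which are again
monotone, with the same part of the risk as first factor. -/
theorem sum_sq_mul_sum_sq_le {a T : ℕ → ℝ} (ha0 : ∀ j, 0 ≤ a j) (ha1 : ∀ j, a j ≤ 1)
    (hT : ∀ j, 0 ≤ T j) (s : Finset ℕ) :
    ∑ j ∈ s, (a j ^ 2) ^ 2 * T j ≤ ∑ j ∈ s, a j ^ 2 * T j := by
  refine Finset.sum_le_sum fun j _ => mul_le_mul_of_nonneg_right ?_ (hT j)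
  exact pow_le_of_le_one (sq_nonneg _) (pow_le_one₀ (ha0 j) (ha1 j)) two_ne_zero

/-- A single random variable whose smallness relative to the optimal risk forces the loss of the
Mallows weights to be close to the least loss. -/
theorem exists_loss_ratio_control [IsProbabilityMeasure P] (hn : 1 ≤ n) (hX : X.rank = p)
    (hk : IsNestedSizes p M k) (hσ : 0 < σ) (hind : iIndepFun ε P)
    (hL : ∀ i, MemLp (ε i) 4 P) (hmean : ∀ i, ∫ ω, ε i ω ∂P = 0)
    (hvar : ∀ i, ∫ ω, ε i ω ^ 2 ∂P = σ ^ 2) (hκ0 : 0 ≤ κ)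
    (hκ : ∀ i, ∫ ω, (ε i ω ^ 2 - σ ^ 2) ^ 2 ∂P ≤ κ) (f : Fin n → ℝ)
    {s2 : Ω → ℝ} (hs2 : MemLp s2 2 P) :
    ∃ Y : Ω → ℝ, Integrable Y P ∧ (∀ ω, 0 ≤ Y ω) ∧
      ∫ ω, Y ω ∂P ≤ (512 * σ ^ 2 + 512 * (2 * κ + 4 * σ ^ 4) / σ ^ 2 + 1 / σ ^ 2) *
        (psi (theta X f) M k + k M * ∫ ω, (s2 ω - σ ^ 2) ^ 2 ∂P) ∧
      ∀ ω δ (u : Fin M → ℝ), 0 ≤ δ → δ ≤ 1 / 20 →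
        0 < n * optRisk P X (nestedModels p M k) f ε →
        Y ω ≤ δ ^ 2 * (n * optRisk P X (nestedModels p M k) f ε) →
        u ∈ stdSimplex ℝ (Fin M) →
        IsMinOn (mmaCriterion X (nestedModels p M k) (s2 ω) (f + fun i => ε i ω))
          (stdSimplex ℝ (Fin M)) u →
        |maLoss X (nestedModels p M k) f u (f + fun i => ε i ω)
          / minLoss X (nestedModels p M k) f (f + fun i => ε i ω) - 1| ≤ 32 * δ := by
  obtain ⟨Z₁, hi₁, hn₁, he₁, hm₁⟩ := exists_signal_majorant hn hX hk hind hL hmean hvar f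
  obtain ⟨Z₂, hi₂, hn₂, he₂, hm₂⟩ :=
    exists_noise_majorant hX hk hind hL hmean hvar hκ0 hκ (theta X f)
  have hn0 : (0 : ℝ) < n := by positivity
  have hσ2 : 0 < σ ^ 2 := by positivity
  have hi₃ : Integrable (fun ω => (s2 ω - σ ^ 2) ^ 2) P :=
    (hs2.sub (memLp_const (σ ^ 2))).integrable_sq
  have hp₁ := hi₁.add (hi₂.const_mul (1 / σ ^ 2))
  have hp₂ := hp₁.add (hi₃.const_mul (k M / σ ^ 2))
  -- One summand per source of error. The factors 1 / σ² arise because the risk contains σ² ∑ γ_j²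
  -- d_j, whereas the noise and variance bounds have ∑ γ_j² d_j as first factor.
  refine ⟨fun ω => Z₁ ω + 1 / σ ^ 2 * Z₂ ω + k M / σ ^ 2 * (s2 ω - σ ^ 2) ^ 2, hp₂, fun ω => ?_,
    ?_, ?_⟩
  · have := hn₁ ω
    have := hn₂ ω
    positivity
  · refine (integral_add hp₁ (hi₃.const_mul (k M / σ ^ 2))).trans_le ?_
    rw [integral_add' hi₁ (hi₂.const_mul (1 / σ ^ 2)), integral_const_mul, integral_const_mul]
    have hψ : 0 ≤ psi (theta X f) M k := zero_le_one.trans (one_le_psi hk _)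
    have hΔ : 0 ≤ k M * ∫ ω, (s2 ω - σ ^ 2) ^ 2 ∂P :=
      mul_nonneg (Nat.cast_nonneg _) (integral_nonneg fun ω => sq_nonneg _)
    have h2 : 1 / σ ^ 2 * ∫ ω, Z₂ ω ∂P ≤
        512 * (2 * κ + 4 * σ ^ 4) / σ ^ 2 * psi (theta X f) M k := by
      refine (mul_le_mul_of_nonneg_left he₂ (by positivity)).trans (le_of_eq ?_)
      ring
    have h3 : k M / σ ^ 2 * ∫ ω, (s2 ω - σ ^ 2) ^ 2 ∂P =
        1 / σ ^ 2 * (k M * ∫ ω, (s2 ω - σ ^ 2) ^ 2 ∂P) := by ring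
    rw [h3]
    have h4 : 0 ≤ 1 / σ ^ 2 * psi (theta X f) M k := by positivity
    have h5 : 0 ≤ (512 * σ ^ 2 + 512 * (2 * κ + 4 * σ ^ 4) / σ ^ 2) *
        (k M * ∫ ω, (s2 ω - σ ^ 2) ^ 2 ∂P) := mul_nonneg (by positivity) hΔ
    linarith
  · intro ω δ u hδ0 hδ hr hY hu hmin
    set T : ℕ → ℝ := fun j => ∑ l ∈ regressors p (k j) (k (j + 1)), (phi X l ⬝ᵥ f) ^ 2 with hT
    set d : ℕ → ℝ := fun j => ((regressors p (k j) (k (j + 1))).card : ℝ) with hd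
    set Ξ : ℕ → ℝ := fun j => ∑ l ∈ regressors p (k j) (k (j + 1)),
      (phi X l ⬝ᵥ fun i => ε i ω) * (phi X l ⬝ᵥ f) with hΞ
    set Q : ℕ → ℝ := fun j => ∑ l ∈ regressors p (k j) (k (j + 1)),
      ((phi X l ⬝ᵥ fun i => ε i ω) ^ 2 - σ ^ 2) with hQ
    have hT0 : ∀ j, 0 ≤ T j := fun j => Finset.sum_nonneg fun l _ => sq_nonneg _
    have hd0 : ∀ j, 0 ≤ d j := fun j => Nat.cast_nonneg _
    set ρ : (Fin M → ℝ) → ℝ := fun w => n * maRisk P X (nestedModels p M k) f ε w with hρ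
    have hdsum : ∑ j ∈ Finset.range M, d j ≤ k M := by
      have := sum_sum_regressors hk.strictMonoOn (fun _ : Fin p => (1 : ℝ)) (Nat.zero_le M) le_rfl
      simp only [Finset.sum_const, nsmul_eq_mul, mul_one] at this
      rw [Finset.range_eq_Ico]
      refine this.le.trans ?_
      rw [card_regressors hk.le]
      exact_mod_cast Nat.sub_le _ _
    have hmain : ∀ w ∈ stdSimplex ℝ (Fin M), n * optRisk P X (nestedModels p M k) f ε ≤ ρ w ∧
        |∑ j ∈ Finset.range M, (1 - cumWeight w j) * Ξ j| ≤ δ * ρ w ∧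
        |∑ j ∈ Finset.range M, (1 - cumWeight w j) ^ 2 * Ξ j| ≤ δ * ρ w ∧
        |∑ j ∈ Finset.range M, cumWeight w j * Q j| ≤ δ * ρ w ∧
        |∑ j ∈ Finset.range M, cumWeight w j ^ 2 * Q j| ≤ δ * ρ w ∧
        |(s2 ω - σ ^ 2) * ∑ j ∈ Finset.range M, cumWeight w j * d j| ≤ δ * ρ w := by
      intro w hw
      have hγ0 := cumWeight_nonneg hw
      have hγ1 := cumWeight_le_one hw
      have hγ := cumWeight_antitone hw
      set γ := cumWeight w
      have ha0 : ∀ j, 0 ≤ 1 - γ j := fun j => sub_nonneg.2 (hγ1 j)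
      have ha1 : ∀ j, 1 - γ j ≤ 1 := fun j => by linarith [hγ0 j]
      have ha : Monotone fun j => 1 - γ j := fun i j hij => sub_le_sub_left (hγ hij) 1
      have hrρ : n * optRisk P X (nestedModels p M k) f ε ≤ ρ w :=
        mul_le_mul_of_nonneg_left (optRisk_le _ f hw) hn0.le
      have hrisk : ρ w = bias X M k f + (∑ j ∈ Finset.range M, (1 - γ j) ^ 2 * T j
          + σ ^ 2 * ∑ j ∈ Finset.range M, γ j ^ 2 * d j) := by
        rw [hρ, Finset.mul_sum, ← Finset.sum_add_distrib]
        refine (mul_maRisk hn hX hk hind hL hmean hvar f w).trans ?_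
        congr 1
        exact Finset.sum_congr rfl fun j _ => by simp only [hT, hd]; ring
      have hbias := bias_nonneg hX hk f
      have hV₁0 : 0 ≤ ∑ j ∈ Finset.range M, (1 - γ j) ^ 2 * T j :=
        Finset.sum_nonneg fun j _ => mul_nonneg (sq_nonneg _) (hT0 j)
      have hV₂0 : 0 ≤ ∑ j ∈ Finset.range M, γ j ^ 2 * d j :=
        Finset.sum_nonneg fun j _ => mul_nonneg (sq_nonneg _) (hd0 j)
      have hV₁ : ∑ j ∈ Finset.range M, (1 - γ j) ^ 2 * T j ≤ ρ w := by
        have := mul_nonneg hσ2.le hV₂0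
        linarith
      have hV₂ : ∑ j ∈ Finset.range M, γ j ^ 2 * d j ≤ ρ w * (1 / σ ^ 2) := by
        rw [mul_one_div, le_div_iff₀' hσ2]
        linarith
      have hz₁ := hn₁ ω
      have hz₂ : 0 ≤ 1 / σ ^ 2 * Z₂ ω := mul_nonneg (by positivity) (hn₂ ω)
      have hz₃ : 0 ≤ k M / σ ^ 2 * (s2 ω - σ ^ 2) ^ 2 := by positivity
      refine ⟨hrρ, ?_, ?_, ?_, ?_, ?_⟩
      · refine abs_le_mul_of_sq_le hδ0 hr.le hrρ ((hm₁ ω _ ha ha0).trans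
          (mul_le_mul_of_nonneg_right hV₁ hz₁)) ?_ hY
        linarith
      · refine abs_le_mul_of_sq_le hδ0 hr.le hrρ ((hm₁ ω (fun j => (1 - γ j) ^ 2)
          (fun i j hij => pow_le_pow_left₀ (ha0 i) (ha hij) 2) fun j => sq_nonneg _).trans
          (mul_le_mul_of_nonneg_right ((sum_sq_mul_sum_sq_le ha0 ha1 hT0 _).trans hV₁) hz₁)) ?_ hY
        linarith
      · refine abs_le_mul_of_sq_le hδ0 hr.le hrρ (((hm₂ ω _ hγ hγ0).trans
          (mul_le_mul_of_nonneg_right hV₂ (hn₂ ω))).trans_eq (mul_assoc _ _ _)) ?_ hY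
        linarith
      · refine abs_le_mul_of_sq_le hδ0 hr.le hrρ (((hm₂ ω (fun j => γ j ^ 2)
          (fun i j hij => pow_le_pow_left₀ (hγ0 j) (hγ hij) 2) fun j => sq_nonneg _).trans
          (mul_le_mul_of_nonneg_right ((sum_sq_mul_sum_sq_le hγ0 hγ1 hd0 _).trans hV₂)
            (hn₂ ω))).trans_eq (mul_assoc _ _ _)) ?_ hY
        linarith
      · refine abs_le_mul_of_sq_le hδ0 hr.le hrρ
          (Y' := k M / σ ^ 2 * (s2 ω - σ ^ 2) ^ 2) ?_ (by linarith) hY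
        -- Cauchy–Schwarz with weights d_j, whose sum is at most k M.
        have hcs : (∑ j ∈ Finset.range M, γ j * d j) ^ 2 ≤
            (∑ j ∈ Finset.range M, d j) * ∑ j ∈ Finset.range M, γ j ^ 2 * d j :=
          Finset.sum_sq_le_sum_mul_sum_of_sq_le_mul _ (fun j _ => hd0 j)
            (fun j _ => mul_nonneg (sq_nonneg _) (hd0 j)) fun j _ => le_of_eq (by ring)
        have h2 := hcs.trans (mul_le_mul hdsum hV₂ hV₂0 (Nat.cast_nonneg _))
        have h3 := mul_le_mul_of_nonneg_left h2 (sq_nonneg (s2 ω - σ ^ 2))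
        rw [mul_pow]
        refine h3.trans_eq ?_
        ring
    have hratio := abs_div_iInf_sub_one_le (W := Fin M → ℝ) (S := stdSimplex ℝ (Fin M))
      (L := fun w => n * maLoss X (nestedModels p M k) f w (f + fun i => ε i ω)) (ρ := ρ)
      (C := fun w => n * mmaCriterion X (nestedModels p M k) (s2 ω) (f + fun i => ε i ω) w)
      (D := fun w => 2 * ∑ j ∈ Finset.range M, (1 - cumWeight w j) * Ξ j
        - 2 * ∑ j ∈ Finset.range M, cumWeight w j * Q j
        + 2 * ((s2 ω - σ ^ 2) * ∑ j ∈ Finset.range M, cumWeight w j * d j))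
      hδ0 hδ hr (fun w hw => (hmain w hw).1) (fun w hw => ?_) (fun w hw => ?_)
      (fun w _ => mmaCriterion_eq hn hX hk w f (fun i => ε i ω) (s2 ω) σ) hu
      (fun w hw => mul_le_mul_of_nonneg_left (hmin hw) hn0.le)
    · rw [← Real.mul_iInf_of_nonneg hn0.le, mul_div_mul_left _ _ hn0.ne'] at hratio
      exact hratio
    · obtain ⟨-, h1, h2, -, h3, -⟩ := hmain w hw
      -- The cross coefficient γ (1 - γ), which is not monotone, is written as (1 - γ) - (1 - γ)².
      -- The three sums cost 1 + 2 + 2 = 5 times δ, and those in D cost 2 + 2 + 2 = 6 times δ.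
      have hdiff : n * maLoss X (nestedModels p M k) f w (f + fun i => ε i ω) - ρ w =
          ∑ j ∈ Finset.range M, cumWeight w j ^ 2 * Q j
          - 2 * ∑ j ∈ Finset.range M, (1 - cumWeight w j) * Ξ j
          + 2 * ∑ j ∈ Finset.range M, (1 - cumWeight w j) ^ 2 * Ξ j := by
        rw [maLoss, mul_inv_cancel_left₀ hn0.ne', sqNorm_maEstimator_sub hX hk]
        simp only [hρ]
        rw [mul_maRisk hn hX hk hind hL hmean hvar, add_sub_add_left_eq_sub,
          ← Finset.sum_sub_distrib, Finset.mul_sum, Finset.mul_sum, ← Finset.sum_sub_distrib,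
          ← Finset.sum_add_distrib]
        refine Finset.sum_congr rfl fun j _ => ?_
        simp only [hQ, hΞ, Finset.sum_sub_distrib, Finset.sum_const, nsmul_eq_mul]
        ring
      rw [hdiff]
      rw [abs_le] at *
      constructor <;> linarith
    · obtain ⟨-, h1, -, h2, -, h3⟩ := hmain w hw
      rw [abs_le] at *
      constructor <;> linarith

end Control

end ModelAveraging

/-! ### Conclusion by Markov's inequality -/

theorem mainTheorem11
    {Ω : Type*} [MeasurableSpace Ω] (P : Measure Ω) [IsProbabilityMeasure P]
    -- the linear models, one for every sample size `n ≥ 1`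
    (p : ℕ → ℕ) (X : (n : ℕ) → Matrix (Fin n) (Fin (p n)) ℝ) (β : (n : ℕ) → Fin (p n) → ℝ)
    (hp : ∀ n, 1 ≤ n → p n ≤ n) (hX : ∀ n, 1 ≤ n → (X n).rank = p n)
    (f : (n : ℕ) → Fin n → ℝ) (hf : ∀ n, f n = X n *ᵥ β n)
    -- i.i.d. sub-Gaussian errors with mean `0` and variance `σ²`
    (σ : ℝ) (hσ : 0 < σ) (η : ℝ≥0) (ε : (n : ℕ) → Fin n → Ω → ℝ)
    (hindep : ∀ n, 1 ≤ n → iIndepFun (ε n) P)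
    (hident : ∀ n, 1 ≤ n → ∀ i j, IdentDistrib (ε n i) (ε n j) P P)
    (hsubG : ∀ n, 1 ≤ n → ∀ i, HasSubgaussianMGF (ε n i) (η ^ 2) P)
    (hmean : ∀ n, 1 ≤ n → ∀ i, ∫ ω, ε n i ω ∂P = 0)
    (hvar : ∀ n, 1 ≤ n → ∀ i, ∫ ω, ε n i ω ^ 2 ∂P = σ ^ 2)
    (y : (n : ℕ) → Ω → Fin n → ℝ) (hy : ∀ n ω i, y n ω i = f n i + ε n i ω)
    -- the nested candidate models
    (M : ℕ → ℕ) (k : ℕ → ℕ → ℕ) (hk : ∀ n, 1 ≤ n → IsNestedSizes (p n) (M n) (k n))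
    -- the estimator of `σ²` and weights that minimize the criterion
    (σhatSq : ℕ → Ω → ℝ) (hσhat : ∀ᶠ n in atTop, MemLp (σhatSq n) 2 P)
    (what : (n : ℕ) → Ω → Fin (M n) → ℝ)
    (hwhat : ∀ n, 1 ≤ n → ∀ ω, what n ω ∈ stdSimplex ℝ (Fin (M n)) ∧
      IsMinOn (mmaCriterion (X n) (nestedModels (p n) (M n) (k n)) (σhatSq n ω) (y n ω))
        (stdSimplex ℝ (Fin (M n))) (what n ω))
    -- `limsup n⁻¹ ‖f‖² < ∞`
    (hbdd : IsBoundedUnder (· ≤ ·) atTop fun n : ℕ => (n : ℝ)⁻¹ * sqNorm (f n))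
    (hvarRate : (fun n : ℕ => (k n (M n) : ℝ) * ∫ ω, (σhatSq n ω - σ ^ 2) ^ 2 ∂P)
      =o[atTop] fun n : ℕ =>
        (n : ℝ) * optRisk P (X n) (nestedModels (p n) (M n) (k n)) (f n) (ε n))
    (hpsiRate : (fun n : ℕ => psi (theta (X n) (f n)) (M n) (k n))
      =o[atTop] fun n : ℕ =>
        (n : ℝ) * optRisk P (X n) (nestedModels (p n) (M n) (k n)) (f n) (ε n)) :
    TendstoInMeasure P
      (fun (n : ℕ) ω =>
        maLoss (X n) (nestedModels (p n) (M n) (k n)) (f n) (what n ω) (y n ω)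
          / minLoss (X n) (nestedModels (p n) (M n) (k n)) (f n) (y n ω))
      atTop (fun _ => 1) := by
  set R : ℕ → ℝ := fun n =>
    (n : ℝ) * optRisk P (X n) (nestedModels (p n) (M n) (k n)) (f n) (ε n) with hR
  set κ : ℝ := 48 * Real.exp ((η ^ 2 : ℝ≥0) / 2) + σ ^ 4 with hκ
  set C : ℝ := 512 * σ ^ 2 + 512 * (2 * κ + 4 * σ ^ 4) / σ ^ 2 + 1 / σ ^ 2 with hC
  set c : ℕ → ℝ := fun n => psi (theta (X n) (f n)) (M n) (k n)
    + (k n (M n) : ℝ) * ∫ ω, (σhatSq n ω - σ ^ 2) ^ 2 ∂P with hc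
  have hcR : c =o[atTop] R := hpsiRate.add hvarRate
  -- As ψ ≥ 1, the rate condition on ψ forces the optimal risk to be eventually positive.
  have hRpos : ∀ᶠ n in atTop, 0 < R n := by
    filter_upwards [hpsiRate.bound one_pos, eventually_ge_atTop 1] with n hn hn1
    have h1 := one_le_psi (hk n hn1) (theta (X n) (f n))
    have h0 : 0 ≤ R n := mul_nonneg (Nat.cast_nonneg _) (optRisk_nonneg _ _)
    rw [one_mul, Real.norm_of_nonneg (zero_le_one.trans h1)] at hn
    change _ ≤ ‖R n‖ at hn
    rw [Real.norm_of_nonneg h0] at hn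
    linarith
  rw [tendstoInMeasure_iff_norm]
  intro e he
  -- Then 32 δ ≤ e / 2 < e, so a deviation of at least e is excluded where Y is small.
  set δ : ℝ := min (1 / 20) (e / 64) with hδ
  have hδ0 : 0 < δ := lt_min (by norm_num) (by positivity)
  have hlim : Tendsto (fun n => ENNReal.ofReal (C / δ ^ 2 * (c n / R n))) atTop (𝓝 0) := by
    have h := (hcR.tendsto_div_nhds_zero).const_mul (C / δ ^ 2)
    rw [mul_zero] at h
    simpa using ENNReal.tendsto_ofReal h
  refine tendsto_of_tendsto_of_tendsto_of_le_of_le' tendsto_const_nhds hlim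
    (Eventually.of_forall fun _ => zero_le) ?_
  filter_upwards [hRpos, hσhat, eventually_ge_atTop 1] with n hRn hs2 hn1
  obtain ⟨Y, hYi, hY0, hYe, hYm⟩ := exists_loss_ratio_control hn1 (hX n hn1) (hk n hn1) hσ
    (hindep n hn1) (fun i => (hsubG n hn1 i).memLp 4) (hmean n hn1) (hvar n hn1)
    (κ := κ) (by positivity) (fun i => integral_sq_sub_sq_le (hsubG n hn1 i) σ) (f n) hs2
  have hy' : ∀ ω, y n ω = f n + fun i => ε n i ω := fun ω => funext fun i => hy n ω i
  have hpos : 0 < δ ^ 2 * R n := by positivity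
  -- The selected weights enter only through this inclusion of sets, so their measurability plays no
  -- role.
  have hsub : {ω | e ≤ ‖maLoss (X n) (nestedModels (p n) (M n) (k n)) (f n) (what n ω) (y n ω)
      / minLoss (X n) (nestedModels (p n) (M n) (k n)) (f n) (y n ω) - 1‖} ⊆
      {ω | δ ^ 2 * R n ≤ Y ω} := by
    intro ω hω
    by_contra hlt
    have hmin := (hwhat n hn1 ω).2
    rw [hy'] at hmin
    have h := hYm ω δ (what n ω) hδ0.le (min_le_left _ _) hRn (not_le.1 hlt).le
      (hwhat n hn1 ω).1 hmin
    have hω' : e ≤ ‖_‖ := hω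
    rw [Real.norm_eq_abs, hy'] at hω'
    have : δ ≤ e / 64 := min_le_right _ _
    linarith
  refine (measure_mono hsub).trans ?_
  rw [← ofReal_measureReal]
  refine ENNReal.ofReal_le_ofReal ?_
  have hmk := mul_meas_ge_le_integral_of_nonneg (Eventually.of_forall hY0) hYi (δ ^ 2 * R n)
  have h1 : P.real {ω | δ ^ 2 * R n ≤ Y ω} ≤ C * c n / (δ ^ 2 * R n) := by
    rw [le_div_iff₀' hpos]
    exact hmk.trans hYe
  refine h1.trans_eq ?_
  rw [mul_div_mul_comm]
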